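/- Let $K$ be a field of characteristic zero and let $S=\langle g_1,\dots,g_n\rangle\subseteq\mathbb N$ ($n\ge 1$) be a numerical semigroup with minimal generators $g_1<g_2<\dots<g_n$, so $\gcd(g_1,\dots,g_n)=1$. Let $\mathrm{Ap}(S)=\{s\in S : s-g_1\notin S\}$. A representation of $s\in S$ is a tuple $\lambda\in\mathbb N^n$ with $s=\sum_{i=1}^n\lambda_i g_i$; the order $\mathrm{ord}(s)$ is the maximum of $\sum_{i=1}^n\lambda_i$ over all representations of $s$, and a representation is maximal if it attains this maximum. For $2\le i\le n$ put $$\beta_i=\max\{h\in\mathbb N : hg_i\in\mathrm{Ap}(S),\ \mathrm{ord}(hg_i)=h\},$$ $$\gamma_i=\max\{h\in\mathbb N : hg_i\in\mathrm{Ap}(S),\ \mathrm{ord}(hg_i)=h,\ hg_i\text{ has a unique maximal representation}\},$$ $$B=\Big\{\sum_{i=2}^n\lambda_i g_i : 0\le\lambda_i\le\beta_i\Big\},\qquad \Gamma=\Big\{\sum_{i=2}^n\lambda_i g_i : 0\le\lambda_i\le\gamma_i\Big\}.$$ Let $K[S]=K[t^{g_1},\dots,t^{g_n}]\subseteq K[t]$,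 let $\overline R=K[S]/(t^{g_1})$, let $\overline{\mathfrak m}$ be the ideal of $\overline R$ generated by the classes of $t^{g_1},\dots,t^{g_n}$, and let $A=\mathrm{gr}_{\overline{\mathfrak m}}(\overline R)=\bigoplus_{j\ge 0}\overline{\mathfrak m}^j/\overline{\mathfrak m}^{j+1}$. Let the defining ideal $I$ of $A$ be the kernel of the surjective $K$-algebra homomorphism $K[x_2,\dots,x_n]\to A$ sending $x_i$ to the class of $t^{g_i}$ in $\overline{\mathfrak m}/\overline{\mathfrak m}^2$. The algebra $A\cong K[x_2,\dots,x_n]/I$ is called a complete intersection if the minimal number of generators of $I$ is $n-1$. Then: 1. $A$ is a complete intersection if and only if $\mathrm{Ap}(S)=\Gamma$. 2. $A$ is a complete intersection and $I$ is generated by monomials if and only if $\mathrm{Ap}(S)=B$. -/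

import Mathlib

/-! ### The associated graded ring of an ideal -/

namespace AssocGraded

/-- The graded piece `I ^ n / I ^ (n + 1)`. -/
abbrev Piece {R : Type*} [CommRing R] (I : Ideal R) (n : ℕ) : Type _ :=
  ↥(I ^ n) ⧸ Submodule.comap (Submodule.subtype (I ^ n)) (I ^ (n + 1))

/-- The class in `I ^ n / I ^ (n + 1)` of an element `a` of `I ^ n`. -/
def cls {R : Type*} [CommRing R] (I : Ideal R) (n : ℕ) (a : R) (ha : a ∈ I ^ n) : Piece I n :=
  Submodule.Quotient.mk ⟨a, ha⟩

theorem exists_cls {R : Type*} [CommRing R] {I : Ideal R} {n : ℕ} (x : Piece I n) :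
    ∃ (a : R) (ha : a ∈ I ^ n), cls I n a ha = x := by
  obtain ⟨⟨a, ha⟩, rfl⟩ := Submodule.Quotient.mk_surjective _ x
  exact ⟨a, ha, rfl⟩

theorem cls_eq_zero_iff {R : Type*} [CommRing R] {I : Ideal R} {n : ℕ} {a : R}
    (ha : a ∈ I ^ n) : cls I n a ha = 0 ↔ a ∈ I ^ (n + 1) := by
  unfold cls
  rw [Submodule.Quotient.mk_eq_zero]
  rfl

theorem mul_mem_pow_add {R : Type*} [CommRing R] {I : Ideal R} {i j : ℕ} {a b : R}
    (ha : a ∈ I ^ i) (hb : b ∈ I ^ j) : a * b ∈ I ^ (i + j) := by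
  rw [pow_add]
  exact Ideal.mul_mem_mul ha hb

/-- Multiplication `I ^ i × I ^ j → I ^ (i + j) / I ^ (i + j + 1)`. -/
def mulAux {R : Type*} [CommRing R] (I : Ideal R) (i j : ℕ) :
    ↥(I ^ i) →ₗ[R] ↥(I ^ j) →ₗ[R] Piece I (i + j) :=
  LinearMap.mk₂ R (fun a b => cls I (i + j) (a * b) (mul_mem_pow_add a.2 b.2))
    (fun a a' b => by
      unfold cls
      rw [← Submodule.Quotient.mk_add]
      congr 1
      exact Subtype.ext (add_mul _ _ _))
    (fun c a b => by
      unfold cls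
      rw [← Submodule.Quotient.mk_smul]
      congr 1
      exact Subtype.ext (mul_assoc _ _ _))
    (fun a b b' => by
      unfold cls
      rw [← Submodule.Quotient.mk_add]
      congr 1
      exact Subtype.ext (mul_add _ _ _))
    (fun c a b => by
      unfold cls
      rw [← Submodule.Quotient.mk_smul]
      congr 1
      exact Subtype.ext (mul_left_comm _ _ _))

/-- Multiplication of graded pieces, induced by the multiplication of the ring. -/
def mulMap {R : Type*} [CommRing R] (I : Ideal R) (i j : ℕ) :
    Piece I i →ₗ[R] Piece I j →ₗ[R] Piece I (i + j) :=
  LinearMap.liftQ₂ _ _ (mulAux I i j)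
    (fun a ha => by
      refine LinearMap.ext fun b => ?_
      refine (cls_eq_zero_iff _).2 ?_
      have h := mul_mem_pow_add (I := I) (i := i + 1) (j := j) ha b.2
      rwa [show i + 1 + j = i + j + 1 by omega] at h)
    (fun b hb => by
      refine LinearMap.ext fun a => ?_
      refine (cls_eq_zero_iff _).2 ?_
      exact mul_mem_pow_add (I := I) (i := i) (j := j + 1) a.2 hb)

theorem mulMap_cls {R : Type*} [CommRing R] {I : Ideal R} {i j : ℕ} {a b : R}
    (ha : a ∈ I ^ i) (hb : b ∈ I ^ j) :
    mulMap I i j (cls I i a ha) (cls I j b hb) = cls I (i + j) (a * b) (mul_mem_pow_add ha hb) :=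
  rfl

theorem mk_cls_eq {R : Type*} [CommRing R] {I : Ideal R} {i j : ℕ} {a b : R}
    (ha : a ∈ I ^ i) (hb : b ∈ I ^ j) (hij : i = j) (hab : a = b) :
    GradedMonoid.mk (A := Piece I) i (cls I i a ha) = GradedMonoid.mk j (cls I j b hb) := by
  subst hij hab
  rfl

theorem one_mem_pow_zero {R : Type*} [CommRing R] (I : Ideal R) (r : R) : r ∈ I ^ 0 := by
  simp

instance gMul {R : Type*} [CommRing R] (I : Ideal R) : GradedMonoid.GMul (Piece I) where
  mul a b := mulMap I _ _ a b

instance gOne {R : Type*} [CommRing R] (I : Ideal R) : GradedMonoid.GOne (Piece I) where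
  one := cls I 0 1 (one_mem_pow_zero I 1)

/-- The graded ring structure on the family `I ^ n / I ^ (n + 1)`. -/
instance gCommRing {R : Type*} [CommRing R] (I : Ideal R) : DirectSum.GCommRing (Piece I) where
  mul a b := mulMap I _ _ a b
  one := cls I 0 1 (one_mem_pow_zero I 1)
  mul_zero a := map_zero _
  zero_mul b := by rw [map_zero, LinearMap.zero_apply]
  mul_add a b c := map_add _ _ _
  add_mul a b c := by rw [map_add, LinearMap.add_apply]
  one_mul := by
    rintro ⟨i, x⟩
    obtain ⟨a, ha, rfl⟩ := exists_cls x
    exact mk_cls_eq _ _ (zero_add i) (one_mul a)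
  mul_one := by
    rintro ⟨i, x⟩
    obtain ⟨a, ha, rfl⟩ := exists_cls x
    exact mk_cls_eq _ _ (add_zero i) (mul_one a)
  mul_assoc := by
    rintro ⟨i, x⟩ ⟨j, y⟩ ⟨k, z⟩
    obtain ⟨a, ha, rfl⟩ := exists_cls x
    obtain ⟨b, hb, rfl⟩ := exists_cls y
    obtain ⟨c, hc, rfl⟩ := exists_cls z
    exact mk_cls_eq _ _ (add_assoc i j k) (mul_assoc a b c)
  mul_comm := by
    rintro ⟨i, x⟩ ⟨j, y⟩
    obtain ⟨a, ha, rfl⟩ := exists_cls x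
    obtain ⟨b, hb, rfl⟩ := exists_cls y
    exact mk_cls_eq _ _ (add_comm i j) (mul_comm a b)
  natCast n := n • cls I 0 1 (one_mem_pow_zero I 1)
  natCast_zero := zero_smul _ _
  natCast_succ n := by rw [add_smul, one_smul]
  intCast n := n • cls I 0 1 (one_mem_pow_zero I 1)
  intCast_ofNat n := natCast_zsmul _ n
  intCast_negSucc_ofNat n := negSucc_zsmul _ n

/-- The associated graded ring `gr_I(R) = ⨁ n, I ^ n / I ^ (n + 1)`. -/
def Gr {R : Type*} [CommRing R] (I : Ideal R) : Type _ :=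
  DirectSum ℕ (Piece I)

instance grCommRing {R : Type*} [CommRing R] (I : Ideal R) : CommRing (Gr I) :=
  inferInstanceAs (CommRing (DirectSum ℕ (Piece I)))

/-- The degree `n` element of `gr_I(R)` given by the class of `a ∈ I ^ n` modulo `I ^ (n + 1)`. -/
def form {R : Type*} [CommRing R] (I : Ideal R) (n : ℕ) (a : R) (ha : a ∈ I ^ n) : Gr I :=
  DirectSum.of (Piece I) n (cls I n a ha)

theorem form_mul {R : Type*} [CommRing R] (I : Ideal R) {i j : ℕ} {a b : R}
    (ha : a ∈ I ^ i) (hb : b ∈ I ^ j) :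
    form I i a ha * form I j b hb = form I (i + j) (a * b) (mul_mem_pow_add ha hb) :=
  DirectSum.of_mul_of (A := Piece I) _ _

/-- The structure map `R → R / I = gr_I(R)_0 → gr_I(R)`. -/
def coeffHom {R : Type*} [CommRing R] (I : Ideal R) : R →+* Gr I where
  toFun r := form I 0 r (one_mem_pow_zero I r)
  map_one' := rfl
  map_zero' := map_zero (DirectSum.of (Piece I) 0)
  map_mul' r s := by
    rw [form_mul]
  map_add' r s := map_add (DirectSum.of (Piece I) 0) (cls I 0 r _) (cls I 0 s _)

end AssocGraded

/-! ### Numerical semigroups and their Apéry sets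

Throughout, `g 0 < g 1 < ⋯ < g d` are the generators of a numerical semigroup. -/

namespace AperyAlgebra

/-- The generators `g 0 < ⋯ < g d` form the minimal system of generators of a numerical
semigroup: they have no common divisor and none of them is a sum of others. -/
structure IsMinimalSystem {d : ℕ} (g : Fin (d + 1) → ℕ) : Prop where
  strictMono : StrictMono g
  gcd_eq_one : Finset.univ.gcd g = 1
  minimal : ∀ i, g i ∉ AddSubmonoid.closure (g '' {j | j ≠ i})

/-- The semigroup `S = ⟨g 0, …, g d⟩`. -/
def semigroup {d : ℕ} (g : Fin (d + 1) → ℕ) : AddSubmonoid ℕ :=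
  AddSubmonoid.closure (Set.range g)

/-- The Apéry set of `S` with respect to `g 0`: the `s ∈ S` with `s - g 0 ∉ S`. -/
def apery {d : ℕ} (g : Fin (d + 1) → ℕ) : Set ℕ :=
  {s | s ∈ semigroup g ∧ ∀ t ∈ semigroup g, t + g 0 ≠ s}

/-- `l` is a representation of `s`. -/
def IsRep {d : ℕ} (g : Fin (d + 1) → ℕ) (s : ℕ) (l : Fin (d + 1) → ℕ) : Prop :=
  s = ∑ i, l i * g i

/-- The order of `s`: the largest size of a representation of `s`. -/
noncomputable def ord {d : ℕ} (g : Fin (d + 1) → ℕ) (s : ℕ) : ℕ :=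
  sSup {k | ∃ l, IsRep g s l ∧ k = ∑ i, l i}

/-- `l` is a maximal representation of `s`. -/
def IsMaxRep {d : ℕ} (g : Fin (d + 1) → ℕ) (s : ℕ) (l : Fin (d + 1) → ℕ) : Prop :=
  IsRep g s l ∧ ord g s = ∑ i, l i

/-- The bound `β` attached to the generator `g (i + 1)`. -/
noncomputable def beta {d : ℕ} (g : Fin (d + 1) → ℕ) (i : Fin d) : ℕ :=
  sSup {h | h * g i.succ ∈ apery g ∧ ord g (h * g i.succ) = h}

/-- The bound `γ` attached to the generator `g (i + 1)`. -/
noncomputable def gamma {d : ℕ} (g : Fin (d + 1) → ℕ) (i : Fin d) : ℕ :=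
  sSup {h | h * g i.succ ∈ apery g ∧ ord g (h * g i.succ) = h ∧
    ∃! l, IsMaxRep g (h * g i.succ) l}

/-- The set of all `∑ l i * g (i + 1)` with `0 ≤ l i ≤ b i`. -/
def hyperRectangle {d : ℕ} (g : Fin (d + 1) → ℕ) (b : Fin d → ℕ) : Set ℕ :=
  {s | ∃ l : Fin d → ℕ, (∀ i, l i ≤ b i) ∧ s = ∑ i, l i * g i.succ}

/-! ### The graded algebra of the Apéry set -/

open Polynomial in
/-- The semigroup ring `K[S] = K[t ^ g 0, …, t ^ g d] ⊆ K[t]`. -/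
noncomputable abbrev semigroupRing (K : Type*) [Field K] {d : ℕ} (g : Fin (d + 1) → ℕ) : Subalgebra K K[X] :=
  Algebra.adjoin K (Set.range fun i => (X : K[X]) ^ g i)

open Polynomial in
/-- The element `t ^ g i` of `K[S]`. -/
noncomputable def gen (K : Type*) [Field K] {d : ℕ} (g : Fin (d + 1) → ℕ) (i : Fin (d + 1)) :
    semigroupRing K g :=
  ⟨(X : K[X]) ^ g i, Algebra.subset_adjoin ⟨i, rfl⟩⟩

/-- The ring `K[S] / (t ^ g 0)`. -/
def reducedRing (K : Type*) [Field K] {d : ℕ} (g : Fin (d + 1) → ℕ) : Type _ :=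
  semigroupRing K g ⧸ Ideal.span {gen K g 0}

noncomputable instance reducedRingCommRing (K : Type*) [Field K] {d : ℕ}
    (g : Fin (d + 1) → ℕ) : CommRing (reducedRing K g) :=
  inferInstanceAs (CommRing (semigroupRing K g ⧸ Ideal.span {gen K g 0}))

noncomputable instance reducedRingAlgebra (K : Type*) [Field K] {d : ℕ}
    (g : Fin (d + 1) → ℕ) : Algebra K (reducedRing K g) :=
  inferInstanceAs (Algebra K (semigroupRing K g ⧸ Ideal.span {gen K g 0}))

/-- The quotient map `K[S] → K[S] / (t ^ g 0)`. -/
noncomputable def toReduced (K : Type*) [Field K] {d : ℕ} (g : Fin (d + 1) → ℕ) :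
    semigroupRing K g →+* reducedRing K g :=
  Ideal.Quotient.mk (Ideal.span {gen K g 0})

/-- The class of `t ^ g i` in `K[S] / (t ^ g 0)`. -/
noncomputable def rgen (K : Type*) [Field K] {d : ℕ} (g : Fin (d + 1) → ℕ) (i : Fin (d + 1)) :
    reducedRing K g :=
  toReduced K g (gen K g i)

/-- The maximal homogeneous ideal of `K[S] / (t ^ g 0)`, generated by the classes of the
`t ^ g i`. -/
noncomputable def maxIdeal (K : Type*) [Field K] {d : ℕ} (g : Fin (d + 1) → ℕ) : Ideal (reducedRing K g) :=
  Ideal.span (Set.range (rgen K g))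

theorem rgen_mem (K : Type*) [Field K] {d : ℕ} (g : Fin (d + 1) → ℕ) (i : Fin (d + 1)) :
    rgen K g i ∈ maxIdeal K g ^ 1 := by
  rw [pow_one]
  exact Ideal.subset_span ⟨i, rfl⟩

/-- The associated graded algebra `A` of the Apéry set. -/
abbrev algebra (K : Type*) [Field K] {d : ℕ} (g : Fin (d + 1) → ℕ) : Type _ :=
  AssocGraded.Gr (maxIdeal K g)

/-- The presentation of `A` in `d` variables: the `i`-th variable goes to the class of
`t ^ g (i + 1)` in degree one, and scalars go to scalars. -/
noncomputable def presentation (K : Type*) [Field K] {d : ℕ} (g : Fin (d + 1) → ℕ) :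
    MvPolynomial (Fin d) K →+* algebra K g :=
  MvPolynomial.eval₂Hom
    ((AssocGraded.coeffHom (maxIdeal K g)).comp (algebraMap K (reducedRing K g)))
    (fun i => AssocGraded.form (maxIdeal K g) 1 (rgen K g i.succ) (rgen_mem K g i.succ))

/-- The defining ideal of `A`. -/
noncomputable def definingIdeal (K : Type*) [Field K] {d : ℕ} (g : Fin (d + 1) → ℕ) :
    Ideal (MvPolynomial (Fin d) K) :=
  RingHom.ker (presentation K g)

/-- `A` is a complete intersection: the minimal number of generators of its defining ideal
is the number `d` of variables. -/
def IsCompleteIntersection (K : Type*) [Field K] {d : ℕ} (g : Fin (d + 1) → ℕ) : Prop :=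
  Submodule.spanFinrank (definingIdeal K g) = d

/-- An ideal generated by monomials. -/
def IsGeneratedByMonomials {K : Type*} [Field K] {d : ℕ} (I : Ideal (MvPolynomial (Fin d) K)) :
    Prop :=
  ∃ E : Set (Fin d →₀ ℕ), I = Ideal.span ((fun e => MvPolynomial.monomial e (1 : K)) '' E)

end AperyAlgebra

namespace AperyAlgebra

/-! ### Orders and representations -/

section Representations

variable {d : ℕ} {g : Fin (d + 1) → ℕ}

/-! A polynomial lies in I exactly when, for every s in Ap(S), its coefficients at the maximal
representations of s sum to zero (`mem_definingIdeal_iff`). So monomials that are not standard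
vanish in A, and standard ones of equal value coincide.

For each i, let the corner be x_i^(γ_i + 1). It either lies in I or has the same image in A as
another standard monomial, which gives d relations; let J ⊆ I be the ideal they generate. Rewriting
corners preserves degree and value and strictly raises the weight ∑ e_i g_i², because a pure power
minimizes this convex weight. It therefore terminates in the box e_i ≤ γ_i (`exists_normalForm`),
and Ap(S) ⊆ Γ always holds.

The corner coefficients vanish on 𝔪I, where 𝔪 is the ideal of the variables, and separate the d
relations. Hence I needs at least d generators, and a Nakayama argument shows that A is a complete
intersection iff I = J (`isCompleteIntersection_iff`). The corners are pairwise coprime, so the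
rewriting is confluent and no box monomial lies in J; thus I = J gives Γ ⊆ Ap(S). Conversely, if
Ap(S) = Γ, box monomials are standard with distinct values, so a normal form lying in I is zero and
I = J.

For the monomial case, a monomial I cannot contain a binomial with standard terms, so γ = β.
Conversely, Ap(S) = B forces Γ = B, hence γ = β, and the relations become pure powers. -/

theorem IsMinimalSystem.pos (hg : IsMinimalSystem g) (i : Fin (d + 1)) : 0 < g i := by
  rcases Nat.eq_zero_or_pos (g i) with h | h
  · exact absurd (by rw [h]; exact zero_mem _) (hg.minimal i)
  · exact h

theorem IsRep.add {s t : ℕ} {l m : Fin (d + 1) → ℕ} (hl : IsRep g s l) (hm : IsRep g t m) :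
    IsRep g (s + t) (l + m) := by
  unfold IsRep at *
  simp only [Pi.add_apply, add_mul, Finset.sum_add_distrib]
  rw [← hl, ← hm]

theorem IsRep.mem_semigroup {s : ℕ} {l : Fin (d + 1) → ℕ} (hl : IsRep g s l) :
    s ∈ semigroup g := by
  rw [hl]
  refine AddSubmonoid.sum_mem _ fun i _ => ?_
  rw [← smul_eq_mul]
  exact AddSubmonoid.nsmul_mem _ (AddSubmonoid.subset_closure (Set.mem_range_self i)) _

theorem exists_isRep {s : ℕ} (hs : s ∈ semigroup g) : ∃ l, IsRep g s l := by
  induction hs using AddSubmonoid.closure_induction with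
  | mem x hx =>
    obtain ⟨i, rfl⟩ := hx
    exact ⟨Pi.single i 1, by simp [IsRep, Pi.single_apply]⟩
  | zero => exact ⟨0, by simp [IsRep]⟩
  | add x y _ _ hx hy =>
    obtain ⟨l, hl⟩ := hx
    obtain ⟨m, hm⟩ := hy
    exact ⟨l + m, hl.add hm⟩

theorem IsRep.sum_le (hpos : ∀ i, 0 < g i) {s : ℕ} {l : Fin (d + 1) → ℕ} (hl : IsRep g s l) :
    ∑ i, l i ≤ s := by
  rw [hl]
  exact Finset.sum_le_sum fun i _ => Nat.le_mul_of_pos_right _ (hpos i)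

theorem bddAbove_lengths (hpos : ∀ i, 0 < g i) (s : ℕ) :
    BddAbove {k | ∃ l, IsRep g s l ∧ k = ∑ i, l i} := by
  refine ⟨s, ?_⟩
  rintro k ⟨l, hl, rfl⟩
  exact hl.sum_le hpos

theorem IsRep.le_ord (hpos : ∀ i, 0 < g i) {s : ℕ} {l : Fin (d + 1) → ℕ} (hl : IsRep g s l) :
    ∑ i, l i ≤ ord g s :=
  le_csSup (bddAbove_lengths hpos s) ⟨l, hl, rfl⟩

theorem exists_isMaxRep (hpos : ∀ i, 0 < g i) {s : ℕ} (hs : s ∈ semigroup g) :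
    ∃ l, IsMaxRep g s l := by
  obtain ⟨m, hm⟩ := exists_isRep hs
  obtain ⟨l, hl, h⟩ := Nat.sSup_mem (s := {k | ∃ l, IsRep g s l ∧ k = ∑ i, l i})
    ⟨_, m, hm, rfl⟩ (bddAbove_lengths hpos s)
  exact ⟨l, hl, h⟩

theorem ord_add_le (hpos : ∀ i, 0 < g i) {s t : ℕ} (hs : s ∈ semigroup g)
    (ht : t ∈ semigroup g) : ord g s + ord g t ≤ ord g (s + t) := by
  obtain ⟨l, hl, hl'⟩ := exists_isMaxRep hpos hs
  obtain ⟨m, hm, hm'⟩ := exists_isMaxRep hpos ht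
  rw [hl', hm', ← Finset.sum_add_distrib]
  exact (hl.add hm).le_ord hpos

theorem mem_apery_of_add {s t : ℕ} (hs : s ∈ semigroup g) (ht : t ∈ semigroup g)
    (h : s + t ∈ apery g) : t ∈ apery g := by
  refine ⟨ht, fun u hu hut => h.2 (s + u) (add_mem hs hu) ?_⟩
  omega

theorem gen_mem_semigroup (i : Fin (d + 1)) : g i ∈ semigroup g :=
  AddSubmonoid.subset_closure ⟨i, rfl⟩

/-- A copy of `g 0` could be removed, leaving s - g 0 in S. Hence exponents in the other d variables
suffice on the Apéry set. -/
theorem IsRep.apply_zero_eq_zero {s : ℕ} {l : Fin (d + 1) → ℕ} (hl : IsRep g s l)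
    (hs : s ∈ apery g) : l 0 = 0 := by
  by_contra h
  obtain ⟨k, hk⟩ := Nat.exists_eq_succ_of_ne_zero h
  have h1 : IsRep g (∑ i, (Fin.cons k (Fin.tail l) : Fin (d + 1) → ℕ) i * g i)
      (Fin.cons k (Fin.tail l)) := rfl
  refine hs.2 _ h1.mem_semigroup ?_
  rw [hl, Fin.sum_univ_succ, Fin.sum_univ_succ, hk, Nat.succ_eq_add_one]
  simp only [Fin.cons_zero, Fin.cons_succ, Fin.tail]
  ring

end Representations

/-! ### Standard exponents -/

section Standard

variable {d : ℕ} (g : Fin (d + 1) → ℕ)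

/-- The semigroup element `∑ e i * g (i + 1)` of an exponent `e`. -/
def value (e : Fin d →₀ ℕ) : ℕ := ∑ i, e i * g i.succ

/-- The exponent `e` is a maximal representation of an element of the Apéry set. -/
def IsStandard (e : Fin d →₀ ℕ) : Prop := value g e ∈ apery g ∧ ord g (value g e) = e.degree

/-- A pure power of a variable whose exponent is the only standard one of its value. -/
def IsIsolated (i : Fin d) (h : ℕ) : Prop :=
  IsStandard g (Finsupp.single i h) ∧
    ∀ e, IsStandard g e → value g e = value g (Finsupp.single i h) → e = Finsupp.single i h

/-- The representation associated with an exponent. -/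
def toRep (e : Fin d →₀ ℕ) : Fin (d + 1) → ℕ := Fin.cons 0 e

variable {g}

theorem value_add (e f : Fin d →₀ ℕ) : value g (e + f) = value g e + value g f := by
  simp [value, add_mul, Finset.sum_add_distrib]

theorem value_single (i : Fin d) (h : ℕ) : value g (Finsupp.single i h) = h * g i.succ := by
  classical
  simp [value, Finsupp.single_apply]

theorem value_zero : value g (0 : Fin d →₀ ℕ) = 0 := by simp [value]

theorem isRep_toRep (e : Fin d →₀ ℕ) : IsRep g (value g e) (toRep e) := by
  simp [IsRep, value, toRep, Fin.sum_univ_succ]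

theorem sum_toRep (e : Fin d →₀ ℕ) : ∑ i, toRep e i = e.degree := by
  simp [toRep, Fin.sum_univ_succ, Finsupp.degree_eq_sum]

theorem toRep_injective : Function.Injective (toRep (d := d)) := fun _ _ h =>
  DFunLike.coe_injective (Fin.cons_right_injective (α := fun _ => ℕ) 0 h)

theorem value_mem_semigroup (e : Fin d →₀ ℕ) : value g e ∈ semigroup g :=
  (isRep_toRep e).mem_semigroup

theorem degree_le_ord (hpos : ∀ i, 0 < g i) (e : Fin d →₀ ℕ) :
    e.degree ≤ ord g (value g e) := by
  rw [← sum_toRep]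
  exact (isRep_toRep e).le_ord hpos

theorem IsRep.exists_toRep {s : ℕ} {l : Fin (d + 1) → ℕ} (hl : IsRep g s l)
    (hs : s ∈ apery g) : ∃ e : Fin d →₀ ℕ, l = toRep e ∧ value g e = s := by
  have h0 := hl.apply_zero_eq_zero hs
  have h : l = toRep (Finsupp.equivFunOnFinite.symm (Fin.tail l)) := by
    conv_lhs => rw [← Fin.cons_self_tail l, h0]
    rfl
  refine ⟨_, h, ?_⟩
  have := isRep_toRep (g := g) (Finsupp.equivFunOnFinite.symm (Fin.tail l))
  rw [← h] at this
  exact this.trans hl.symm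

theorem exists_isStandard (hpos : ∀ i, 0 < g i) {s : ℕ} (hs : s ∈ apery g) :
    ∃ e, IsStandard g e ∧ value g e = s := by
  obtain ⟨l, hl, hl'⟩ := exists_isMaxRep hpos hs.1
  obtain ⟨e, rfl, he⟩ := hl.exists_toRep hs
  exact ⟨e, ⟨he ▸ hs, by rw [he, hl', sum_toRep]⟩, he⟩

/-- Since `ord` is superadditive and bounds the degree from above, equality for the sum forces
equality for each summand. Standard exponents thus form a lower set. -/
theorem IsStandard.of_add (hpos : ∀ i, 0 < g i) {e f : Fin d →₀ ℕ}
    (h : IsStandard g (e + f)) : IsStandard g e := by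
  obtain ⟨h1, h2⟩ := h
  rw [value_add] at h1 h2
  refine ⟨mem_apery_of_add (value_mem_semigroup f) (value_mem_semigroup e)
    (by rwa [add_comm]), ?_⟩
  have h3 := ord_add_le hpos (value_mem_semigroup (g := g) e) (value_mem_semigroup f)
  have h4 := degree_le_ord hpos e
  have h5 := degree_le_ord hpos f
  rw [map_add] at h2
  omega

theorem IsStandard.of_le (hpos : ∀ i, 0 < g i) {e f : Fin d →₀ ℕ}
    (h : IsStandard g f) (hef : e ≤ f) : IsStandard g e := by
  rw [← add_tsub_cancel_of_le hef] at h
  exact h.of_add hpos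

/-- Standardness depends only on value and degree, so part of a standard exponent may be swapped. -/
theorem IsStandard.add_of_value_eq {e f k : Fin d →₀ ℕ}
    (h : IsStandard g (e + k)) (hv : value g f = value g e) (hd : f.degree = e.degree) :
    IsStandard g (f + k) := by
  unfold IsStandard at *
  rw [value_add, map_add] at *
  rwa [hv, hd]

theorem IsStandard.degree_eq {e f : Fin d →₀ ℕ} (he : IsStandard g e) (hf : IsStandard g f)
    (h : value g e = value g f) : e.degree = f.degree := by
  rw [← he.2, ← hf.2, h]

theorem zero_mem_apery (hpos : ∀ i, 0 < g i) : 0 ∈ apery g :=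
  ⟨zero_mem _, fun t _ h => by have := hpos 0; omega⟩

theorem isStandard_zero (hpos : ∀ i, 0 < g i) : IsStandard g 0 := by
  refine ⟨by rw [value_zero]; exact zero_mem_apery hpos, ?_⟩
  obtain ⟨l, hl, h⟩ := exists_isMaxRep hpos (zero_mem (semigroup g))
  have := hl.sum_le hpos
  rw [value_zero, map_zero]
  omega

theorem isStandard_single_iff (i : Fin d) (h : ℕ) :
    IsStandard g (Finsupp.single i h) ↔
      h * g i.succ ∈ apery g ∧ ord g (h * g i.succ) = h := by
  rw [IsStandard, value_single, Finsupp.degree_single]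

theorem isIsolated_iff (i : Fin d) (h : ℕ) :
    IsIsolated g i h ↔ h * g i.succ ∈ apery g ∧ ord g (h * g i.succ) = h ∧
      ∃! l, IsMaxRep g (h * g i.succ) l := by
  rw [IsIsolated, isStandard_single_iff, and_assoc]
  refine and_congr_right fun h1 => and_congr_right fun h2 => ?_
  have hmax : ∀ e, value g e = h * g i.succ → IsStandard g e →
      IsMaxRep g (h * g i.succ) (toRep e) := fun e he hs =>
    ⟨he ▸ isRep_toRep e, by rw [sum_toRep, ← hs.2, he]⟩
  have hs := (isStandard_single_iff i h).2 ⟨h1, h2⟩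
  constructor
  · intro H
    refine ⟨toRep (Finsupp.single i h), hmax _ (value_single i h) hs, ?_⟩
    rintro l ⟨hl, hl'⟩
    obtain ⟨e, rfl, he⟩ := hl.exists_toRep h1
    rw [H e ⟨he ▸ h1, by rw [he, hl', sum_toRep]⟩ (by rw [he, value_single])]
  · intro H e he hv
    rw [value_single] at hv
    exact toRep_injective (H.unique (hmax e hv he) (hmax _ (value_single i h) hs))

/-- Here `g 0` copies of `g i.succ` equal `g i.succ` copies of `g 0`, which is outside the Apéry
set. This bound makes the suprema defining β and γ attained maxima. -/
theorem lt_of_isStandard_single (hpos : ∀ i, 0 < g i) {i : Fin d} {h : ℕ}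
    (hs : IsStandard g (Finsupp.single i h)) : h < g 0 := by
  by_contra! hle
  have h1 : IsStandard g (Finsupp.single i (g 0)) :=
    hs.of_le hpos (Finsupp.single_le_single.2 hle)
  obtain ⟨k, hk⟩ := Nat.exists_eq_succ_of_ne_zero (hpos i.succ).ne'
  refine h1.1.2 (k * g 0) ?_ ?_
  · rw [← smul_eq_mul]
    exact AddSubmonoid.nsmul_mem _ (gen_mem_semigroup 0) k
  · rw [value_single, hk]
    simp only [Nat.succ_eq_add_one]
    ring

theorem gamma_eq (i : Fin d) : gamma g i = sSup {h | IsIsolated g i h} := by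
  simp only [gamma, isIsolated_iff]

theorem beta_eq (i : Fin d) : beta g i = sSup {h | IsStandard g (Finsupp.single i h)} := by
  simp only [beta, isStandard_single_iff]

theorem bddAbove_isStandard (hpos : ∀ i, 0 < g i) (i : Fin d) :
    BddAbove {h | IsStandard g (Finsupp.single i h)} :=
  ⟨g 0, fun _ h => (lt_of_isStandard_single hpos h).le⟩

theorem bddAbove_isIsolated (hpos : ∀ i, 0 < g i) (i : Fin d) :
    BddAbove {h | IsIsolated g i h} :=
  (bddAbove_isStandard hpos i).mono fun _ h => h.1

theorem isIsolated_zero (hpos : ∀ i, 0 < g i) (i : Fin d) : IsIsolated g i 0 := by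
  have h0 : IsStandard g (Finsupp.single i 0) := by
    rw [Finsupp.single_zero]; exact isStandard_zero hpos
  refine ⟨h0, fun e he hv => ?_⟩
  have := he.degree_eq h0 hv
  rw [Finsupp.degree_single, Finsupp.degree_eq_zero_iff] at this
  rw [this, Finsupp.single_zero]

theorem isIsolated_gamma (hpos : ∀ i, 0 < g i) (i : Fin d) : IsIsolated g i (gamma g i) := by
  rw [gamma_eq]
  exact Nat.sSup_mem (s := {h | IsIsolated g i h}) ⟨0, isIsolated_zero hpos i⟩
    (bddAbove_isIsolated hpos i)

theorem not_isIsolated_gamma_succ (hpos : ∀ i, 0 < g i) (i : Fin d) :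
    ¬ IsIsolated g i (gamma g i + 1) := fun h => by
  have := le_csSup (bddAbove_isIsolated hpos i) h
  rw [← gamma_eq] at this
  omega

theorem le_beta (hpos : ∀ i, 0 < g i) {i : Fin d} {h : ℕ}
    (hs : IsStandard g (Finsupp.single i h)) : h ≤ beta g i := by
  rw [beta_eq]
  exact le_csSup (bddAbove_isStandard hpos i) hs

theorem isStandard_beta (hpos : ∀ i, 0 < g i) (i : Fin d) :
    IsStandard g (Finsupp.single i (beta g i)) := by
  rw [beta_eq]
  exact Nat.sSup_mem (s := {h | IsStandard g (Finsupp.single i h)})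
    ⟨0, (isIsolated_zero hpos i).1⟩ (bddAbove_isStandard hpos i)

theorem gamma_le_beta (hpos : ∀ i, 0 < g i) (i : Fin d) : gamma g i ≤ beta g i :=
  le_beta hpos (isIsolated_gamma hpos i).1

/-- Beyond `γ i`, a standard pure power can be exchanged for another standard exponent. -/
theorem exists_exchange (hpos : ∀ i, 0 < g i) {i : Fin d}
    (hs : IsStandard g (Finsupp.single i (gamma g i + 1))) :
    ∃ e, IsStandard g e ∧ value g e = value g (Finsupp.single i (gamma g i + 1)) ∧
      e ≠ Finsupp.single i (gamma g i + 1) := by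
  by_contra! H
  exact not_isIsolated_gamma_succ hpos i ⟨hs, H⟩

theorem gamma_lt_beta_iff (hpos : ∀ i, 0 < g i) (i : Fin d) :
    gamma g i < beta g i ↔ IsStandard g (Finsupp.single i (gamma g i + 1)) :=
  ⟨fun h => (isStandard_beta hpos i).of_le hpos (Finsupp.single_le_single.2 h),
    fun h => le_beta hpos h⟩

/-! ### The quadratic weight -/

/-- The weight `∑ e i * g (i + 1) ^ 2`. -/
def weight (g : Fin (d + 1) → ℕ) (e : Fin d →₀ ℕ) : ℕ := ∑ i, e i * g i.succ ^ 2

theorem weight_add (e f : Fin d →₀ ℕ) : weight g (e + f) = weight g e + weight g f := by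
  simp [weight, add_mul, Finset.sum_add_distrib]

theorem weight_single (i : Fin d) (h : ℕ) :
    weight g (Finsupp.single i h) = h * g i.succ ^ 2 := by
  classical
  simp [weight, Finsupp.single_apply]

theorem weight_le (e : Fin d →₀ ℕ) : weight g e ≤ e.degree * ∑ i : Fin d, g i.succ ^ 2 := by
  rw [weight, Finsupp.degree_eq_sum, Finset.sum_mul]
  refine Finset.sum_le_sum fun i _ => Nat.mul_le_mul_left _ ?_
  exact Finset.single_le_sum (f := fun i : Fin d => g i.succ ^ 2) (fun _ _ => Nat.zero_le _)
    (Finset.mem_univ i)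

/-- By strict convexity, a pure power has the smallest weight among the exponents of the same
degree and value. -/
theorem weight_single_lt (hinj : Function.Injective g) {i : Fin d} {h : ℕ} {e : Fin d →₀ ℕ}
    (hd : e.degree = h) (hv : value g e = value g (Finsupp.single i h))
    (hne : e ≠ Finsupp.single i h) : weight g (Finsupp.single i h) < weight g e := by
  classical
  rw [value_single] at hv
  have hex : ∃ j, j ≠ i ∧ e j ≠ 0 := by
    by_contra! H
    have he : e = Finsupp.single i (e i) := by
      ext j
      rcases eq_or_ne j i with rfl | hj
      · simp
      · rw [H j hj, Finsupp.single_eq_of_ne hj]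
    rw [he, Finsupp.degree_single] at hd
    rw [hd] at he
    exact hne he
  obtain ⟨j, hji, hj⟩ := hex
  -- A variance about `g i.succ`: with the degree and value of e prescribed, it expands to the
  -- difference of the two weights.
  have hpos : 0 < ∑ k, (e k : ℤ) * ((g k.succ : ℤ) - g i.succ) ^ 2 := by
    refine Finset.sum_pos' (fun k _ => by positivity) ⟨j, Finset.mem_univ j, ?_⟩
    have h1 : (g j.succ : ℤ) - g i.succ ≠ 0 := fun h0 =>
      hji (Fin.succ_injective d (hinj (by omega)))
    have h2 : 0 < (e j : ℤ) := by omega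
    positivity
  have hsum : ∑ k, (e k : ℤ) * ((g k.succ : ℤ) - g i.succ) ^ 2 =
      (weight g e : ℤ) - 2 * g i.succ * value g e + g i.succ ^ 2 * e.degree := by
    rw [weight, value, Finsupp.degree_eq_sum]
    push_cast
    rw [Finset.mul_sum, Finset.mul_sum, ← Finset.sum_sub_distrib, ← Finset.sum_add_distrib]
    exact Finset.sum_congr rfl fun k _ => by ring
  rw [hsum, hv, hd] at hpos
  rw [weight_single]
  push_cast at hpos
  zify
  nlinarith

end Standard

end AperyAlgebra

/-! ### Forms and components in the associated graded ring -/

namespace AssocGraded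

theorem form_congr {R : Type*} [CommRing R] (I : Ideal R) {i j : ℕ} {a b : R}
    (ha : a ∈ I ^ i) (hb : b ∈ I ^ j) (hij : i = j) (hab : a = b) :
    form I i a ha = form I j b hb := by
  subst hij hab
  rfl

theorem form_pow {R : Type*} [CommRing R] (I : Ideal R) {i : ℕ} {a : R}
    (ha : a ∈ I ^ i) (k : ℕ) (hk : a ^ k ∈ I ^ (k * i)) :
    form I i a ha ^ k = form I (k * i) (a ^ k) hk := by
  induction k with
  | zero =>
    rw [pow_zero]
    exact form_congr I (one_mem_pow_zero I 1) hk (zero_mul i).symm (pow_zero a).symm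
  | succ k ih =>
    have h : a ^ k ∈ I ^ (k * i) := by rw [mul_comm, pow_mul]; exact Ideal.pow_mem_pow ha k
    rw [pow_succ, ih h, form_mul]
    exact form_congr I _ _ (by ring) (pow_succ a k).symm

/-- The degree `n` component of an element of `gr_I(R)`. -/
def component {R : Type*} [CommRing R] (I : Ideal R) (n : ℕ) : Gr I →+ Piece I n :=
  DFinsupp.evalAddMonoidHom n

theorem component_form_self {R : Type*} [CommRing R] (I : Ideal R) {i : ℕ} {a : R}
    (ha : a ∈ I ^ i) : component I i (form I i a ha) = cls I i a ha :=
  DirectSum.of_eq_same _ _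

theorem component_form_of_ne {R : Type*} [CommRing R] (I : Ideal R) {i j : ℕ} {a : R}
    (ha : a ∈ I ^ i) (h : j ≠ i) : component I j (form I i a ha) = 0 :=
  DirectSum.of_eq_of_ne _ _ _ h

theorem eq_zero_iff_component {R : Type*} [CommRing R] (I : Ideal R) (x : Gr I) :
    x = 0 ↔ ∀ n, component I n x = 0 :=
  DFinsupp.ext_iff

end AssocGraded

namespace AperyAlgebra

open AssocGraded

/-! ### Powers of the maximal ideal -/

section Powers

variable {K : Type*} [Field K] {d : ℕ} {g : Fin (d + 1) → ℕ}

theorem mem_semigroup_of_coeff_ne_zero (p : semigroupRing K g) {s : ℕ}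
    (hs : (p : Polynomial K).coeff s ≠ 0) : s ∈ semigroup g := by
  obtain ⟨p, hp⟩ := p
  induction hp using Algebra.adjoin_induction generalizing s with
  | mem x hx =>
    obtain ⟨i, rfl⟩ := hx
    simp only [Polynomial.coeff_X_pow, ne_eq, ite_eq_right_iff, one_ne_zero, imp_false,
      not_not] at hs
    exact hs ▸ gen_mem_semigroup i
  | algebraMap r =>
    simp only [Polynomial.algebraMap_apply, Algebra.algebraMap_self, RingHom.id_apply,
      Polynomial.coeff_C, ne_eq, ite_eq_right_iff, not_forall] at hs
    exact hs.1 ▸ zero_mem _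
  | add x y _ _ hx hy =>
    by_cases h : x.coeff s = 0
    · exact hy (by simpa [h] using hs)
    · exact hx h
  | mul x y _ _ hx hy =>
    simp only [Polynomial.coeff_mul] at hs
    obtain ⟨⟨a, b⟩, hab, h⟩ := Finset.exists_ne_zero_of_sum_ne_zero hs
    rw [← Finset.HasAntidiagonal.mem_antidiagonal.1 hab]
    exact add_mem (hx (left_ne_zero_of_mul h)) (hy (right_ne_zero_of_mul h))

theorem coe_prod_gen_pow (l : Fin (d + 1) → ℕ) :
    ((∏ i, gen K g i ^ l i : semigroupRing K g) : Polynomial K) =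
      Polynomial.X ^ ∑ i, l i * g i := by
  rw [← Finset.prod_pow_eq_pow_sum]
  simp [gen, ← pow_mul, mul_comm]

/-- The monomial `t ^ s` of `K[S]`. -/
noncomputable def tpow (K : Type*) [Field K] {g : Fin (d + 1) → ℕ} {s : ℕ}
    (hs : s ∈ semigroup g) : semigroupRing K g :=
  ⟨Polynomial.X ^ s, by
    obtain ⟨l, hl⟩ := exists_isRep hs
    rw [hl, ← coe_prod_gen_pow]
    exact Subtype.property _⟩

/-- The elements of `K[S]` whose terms in the Apéry set have order at least `j`. -/
noncomputable def orderIdeal (K : Type*) [Field K] {g : Fin (d + 1) → ℕ} (hpos : ∀ i, 0 < g i)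
    (j : ℕ) : Ideal (semigroupRing K g) where
  carrier := {p | ∀ s ∈ apery g, (p : Polynomial K).coeff s ≠ 0 → j ≤ ord g s}
  zero_mem' := fun s _ h => by simp at h
  add_mem' := by
    intro p q hp hq s hs h
    by_cases h' : (p : Polynomial K).coeff s = 0
    · exact hq s hs (by simpa [h'] using h)
    · exact hp s hs h'
  smul_mem' := by
    intro p q hq s hs h
    simp only [smul_eq_mul, Subalgebra.coe_mul, Polynomial.coeff_mul] at h
    obtain ⟨⟨a, b⟩, hab, hne⟩ := Finset.exists_ne_zero_of_sum_ne_zero h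
    obtain rfl := Finset.HasAntidiagonal.mem_antidiagonal.1 hab
    have ha := mem_semigroup_of_coeff_ne_zero p (left_ne_zero_of_mul hne)
    have hb := mem_semigroup_of_coeff_ne_zero q (right_ne_zero_of_mul hne)
    have h1 := hq b (mem_apery_of_add ha hb hs) (right_ne_zero_of_mul hne)
    exact h1.trans (le_of_add_le_right (ord_add_le hpos ha hb))

theorem orderIdeal_mul_le (hpos : ∀ i, 0 < g i) (j k : ℕ) :
    orderIdeal K hpos j * orderIdeal K hpos k ≤ orderIdeal K hpos (j + k) := by
  rw [Ideal.mul_le]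
  intro p hp q hq s hs h
  simp only [Subalgebra.coe_mul, Polynomial.coeff_mul] at h
  obtain ⟨⟨a, b⟩, hab, hne⟩ := Finset.exists_ne_zero_of_sum_ne_zero h
  obtain rfl := Finset.HasAntidiagonal.mem_antidiagonal.1 hab
  dsimp only at *
  have ha := mem_semigroup_of_coeff_ne_zero p (left_ne_zero_of_mul hne)
  have hb := mem_semigroup_of_coeff_ne_zero q (right_ne_zero_of_mul hne)
  have h1 := hq b (mem_apery_of_add ha hb hs) (right_ne_zero_of_mul hne)
  have h3 := hp a (mem_apery_of_add hb ha (by rwa [add_comm])) (left_ne_zero_of_mul hne)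
  have h2 := ord_add_le hpos ha hb
  omega

theorem gen_mem_orderIdeal (hpos : ∀ i, 0 < g i) (i : Fin (d + 1)) :
    gen K g i ∈ orderIdeal K hpos 1 := by
  intro s _ h
  simp only [gen, Polynomial.coeff_X_pow, ne_eq, ite_eq_right_iff, one_ne_zero, imp_false,
    not_not] at h
  have : IsRep g s (Pi.single i 1) := by simp [IsRep, Pi.single_apply, h]
  simpa using this.le_ord hpos

theorem span_gen_pow_le (hpos : ∀ i, 0 < g i) (j : ℕ) :
    Ideal.span (Set.range (gen K g)) ^ j ≤ orderIdeal K hpos j := by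
  induction j with
  | zero => exact fun p _ s _ _ => Nat.zero_le _
  | succ j ih =>
    rw [pow_succ]
    refine (Ideal.mul_mono ih (Ideal.span_le.2 ?_)).trans (orderIdeal_mul_le hpos j 1)
    rintro _ ⟨i, rfl⟩
    exact gen_mem_orderIdeal hpos i

/-- Its only exponent is outside the Apéry set, so the order condition is vacuous. This makes the
order ideals visible in the quotient by `t ^ g 0`. -/
theorem gen_zero_mem_orderIdeal (hpos : ∀ i, 0 < g i) (j : ℕ) :
    gen K g 0 ∈ orderIdeal K hpos j := by
  intro s hs h
  simp only [gen, Polynomial.coeff_X_pow, ne_eq, ite_eq_right_iff, one_ne_zero, imp_false,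
    not_not] at h
  exact absurd (by rw [h, zero_add]) (hs.2 0 (zero_mem _))

/-- For s in the Apéry set, a maximal representation writes t^s as a product of ord(s) generators;
otherwise t^s is a multiple of `t ^ g 0`. -/
theorem tpow_mem (hpos : ∀ i, 0 < g i) {s j : ℕ} (hs : s ∈ semigroup g)
    (h : s ∈ apery g → j ≤ ord g s) :
    tpow K hs ∈ Ideal.span (Set.range (gen K g)) ^ j ⊔ Ideal.span {gen K g 0} := by
  by_cases ha : s ∈ apery g
  · refine Ideal.mem_sup_left ?_
    obtain ⟨l, hl, hl'⟩ := exists_isMaxRep hpos hs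
    have h1 : tpow K hs = ∏ i, gen K g i ^ l i :=
      Subtype.ext (by rw [coe_prod_gen_pow, ← hl]; rfl)
    rw [h1]
    refine Ideal.pow_le_pow_right (h ha) ?_
    rw [hl', ← Finset.prod_pow_eq_pow_sum]
    exact Ideal.prod_mem_prod fun i _ =>
      Ideal.pow_mem_pow (Ideal.subset_span (Set.mem_range_self i)) _
  · refine Ideal.mem_sup_right (Ideal.mem_span_singleton'.2 ?_)
    have : ∃ t ∈ semigroup g, t + g 0 = s := by
      by_contra! H
      exact ha ⟨hs, H⟩
    obtain ⟨t, ht, rfl⟩ := this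
    exact ⟨tpow K ht, Subtype.ext (pow_add _ _ _).symm⟩

theorem eq_sum_tpow (p : semigroupRing K g) :
    p = ∑ s : (p : Polynomial K).support, (p : Polynomial K).coeff s •
      tpow K (mem_semigroup_of_coeff_ne_zero p (Polynomial.mem_support_iff.1 s.2)) := by
  refine Subtype.ext ?_
  conv_lhs => rw [(p : Polynomial K).as_sum_support_C_mul_X_pow]
  rw [AddSubmonoidClass.coe_finsetSum,
    ← Finset.sum_coe_sort (p : Polynomial K).support]
  refine Finset.sum_congr rfl fun s _ => ?_
  rw [← Polynomial.smul_eq_C_mul]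
  rfl

theorem maxIdeal_eq_map :
    maxIdeal K g = (Ideal.span (Set.range (gen K g))).map (toReduced K g) := by
  rw [Ideal.map_span, ← Set.range_comp]
  rfl

theorem toReduced_surjective : Function.Surjective (toReduced K g) :=
  Ideal.Quotient.mk_surjective

theorem ker_toReduced : RingHom.ker (toReduced K g) = Ideal.span {gen K g 0} :=
  Ideal.mk_ker

/-- The pullback of the power to K[S] is a power of the generator ideal plus `(t ^ g 0)`.
Superadditivity of `ord` gives one inclusion; the other is checked term by term. -/
theorem toReduced_mem_pow_iff (hpos : ∀ i, 0 < g i) {j : ℕ} {p : semigroupRing K g} :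
    toReduced K g p ∈ maxIdeal K g ^ j ↔ p ∈ orderIdeal K hpos j := by
  rw [maxIdeal_eq_map, ← Ideal.map_pow, ← Ideal.mem_comap,
    Ideal.comap_map_of_surjective' _ toReduced_surjective, ker_toReduced]
  constructor
  · intro h
    exact sup_le (span_gen_pow_le hpos j)
      ((Ideal.span_singleton_le_iff_mem _).2 (gen_zero_mem_orderIdeal hpos j)) h
  · intro h
    rw [eq_sum_tpow p]
    refine Submodule.sum_mem _ fun s _ => Submodule.smul_of_tower_mem _ _ ?_
    exact tpow_mem hpos _ fun hs => h s hs (Polynomial.mem_support_iff.1 s.2)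

end Powers

/-! ### The defining ideal -/

section DefiningIdeal

open MvPolynomial

variable {K : Type*} [Field K] {d : ℕ} {g : Fin (d + 1) → ℕ}

/-- The evaluation of polynomials at the elements `t ^ g (i + 1)` of `K[S]`. -/
noncomputable def evalGen (K : Type*) [Field K] (g : Fin (d + 1) → ℕ) :
    MvPolynomial (Fin d) K →ₐ[K] semigroupRing K g :=
  aeval fun i => gen K g i.succ

theorem coe_evalGen_monomial (e : Fin d →₀ ℕ) (c : K) :
    (evalGen K g (monomial e c) : Polynomial K) = Polynomial.monomial (value g e) c := by
  rw [evalGen, aeval_monomial, ← Polynomial.C_mul_X_pow_eq_monomial, value,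
    ← Finset.prod_pow_eq_pow_sum, Finsupp.prod_fintype _ _ (fun _ => pow_zero _)]
  simp [gen, ← pow_mul, mul_comm]

theorem coeff_evalGen (f : MvPolynomial (Fin d) K) (s : ℕ) :
    (evalGen K g f : Polynomial K).coeff s =
      ∑ e ∈ f.support with value g e = s, f.coeff e := by
  conv_lhs => rw [f.as_sum, map_sum, AddSubmonoidClass.coe_finsetSum,
    Polynomial.finsetSum_coeff]
  rw [Finset.sum_filter]
  exact Finset.sum_congr rfl fun e _ => by
    rw [coe_evalGen_monomial, Polynomial.coeff_monomial]

theorem evalGen_mem_pow (hpos : ∀ i, 0 < g i) {f : MvPolynomial (Fin d) K} {n : ℕ}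
    (hf : ∀ e ∈ f.support, e.degree = n) :
    toReduced K g (evalGen K g f) ∈ maxIdeal K g ^ n := by
  rw [toReduced_mem_pow_iff hpos]
  intro s _ h
  rw [coeff_evalGen] at h
  obtain ⟨e, he, _⟩ := Finset.exists_ne_zero_of_sum_ne_zero h
  rw [Finset.mem_filter] at he
  rw [← hf e he.1, ← he.2]
  exact degree_le_ord hpos e

theorem degree_of_mem_support_monomial {e e' : Fin d →₀ ℕ} {c : K}
    (h : e' ∈ (monomial e c).support) : e'.degree = e.degree := by
  rw [Finset.mem_singleton.1 (support_monomial_subset h)]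

theorem presentation_monomial_one (hpos : ∀ i, 0 < g i) (e : Fin d →₀ ℕ) :
    presentation K g (monomial e 1) = form (maxIdeal K g) e.degree
      (toReduced K g (evalGen K g (monomial e 1)))
      (evalGen_mem_pow hpos fun _ => degree_of_mem_support_monomial) := by
  induction e using Finsupp.induction_linear with
  | zero =>
    change presentation K g 1 = _
    rw [map_one]
    exact form_congr _ (one_mem_pow_zero _ 1) _ (map_zero _).symm
      (by change 1 = toReduced K g (evalGen K g 1); rw [map_one, map_one])
  | add e f he hf =>
    have : (monomial (e + f) 1 : MvPolynomial (Fin d) K) = monomial e 1 * monomial f 1 := by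
      rw [monomial_mul, mul_one]
    refine (congrArg (presentation K g) this).trans ?_
    rw [map_mul, he, hf, form_mul]
    exact form_congr _ _ _ (map_add _ _ _).symm (by rw [this, map_mul, map_mul])
  | single i k =>
    have : (monomial (Finsupp.single i k) 1 : MvPolynomial (Fin d) K) = X i ^ k :=
      X_pow_eq_monomial.symm
    have h2 : presentation K g (X i) =
        form (maxIdeal K g) 1 (rgen K g i.succ) (rgen_mem K g i.succ) := eval₂Hom_X' _ _ _
    have h3 : evalGen K g (X i) = gen K g i.succ := aeval_X _ _
    refine (congrArg (presentation K g) this).trans ?_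
    rw [map_pow, h2, form_pow _ _ _ (by
      rw [mul_one]; exact Ideal.pow_mem_pow (by simpa using rgen_mem K g i.succ) k)]
    exact form_congr _ _ _ (by rw [mul_one, Finsupp.degree_single])
      (by rw [this, map_pow, map_pow, h3]; rfl)

theorem presentation_monomial (hpos : ∀ i, 0 < g i) (e : Fin d →₀ ℕ) (c : K) :
    presentation K g (monomial e c) = form (maxIdeal K g) e.degree
      (toReduced K g (evalGen K g (monomial e c)))
      (evalGen_mem_pow hpos fun _ => degree_of_mem_support_monomial) := by
  have h1 : (monomial e c : MvPolynomial (Fin d) K) = C c * monomial e 1 := by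
    rw [C_mul_monomial, mul_one]
  have h2 : presentation K g (C c) = form (maxIdeal K g) 0
      (algebraMap K (reducedRing K g) c) (one_mem_pow_zero _ _) := eval₂Hom_C _ _ _
  have h3 : toReduced K g (evalGen K g (C c)) = algebraMap K (reducedRing K g) c := by
    rw [← algebraMap_eq, AlgHom.commutes]
    rfl
  refine (congrArg (presentation K g) h1).trans ?_
  rw [map_mul, h2, presentation_monomial_one hpos, form_mul]
  exact form_congr _ _ _ (zero_add _) (by rw [h1, map_mul, map_mul, h3])

theorem component_presentation (hpos : ∀ i, 0 < g i) (f : MvPolynomial (Fin d) K) (n : ℕ)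
    (h : toReduced K g (evalGen K g (homogeneousComponent n f)) ∈ maxIdeal K g ^ n) :
    component (maxIdeal K g) n (presentation K g f) =
      cls (maxIdeal K g) n (toReduced K g (evalGen K g (homogeneousComponent n f))) h := by
  have hmem : ∀ f : MvPolynomial (Fin d) K,
      toReduced K g (evalGen K g (homogeneousComponent n f)) ∈ maxIdeal K g ^ n := fun f =>
    evalGen_mem_pow hpos fun e he => by
      rw [support_homogeneousComponent, Finset.mem_filter] at he
      exact he.2
  induction f using MvPolynomial.induction_on' with
  | monomial e c =>
    have hc : homogeneousComponent n (monomial e c : MvPolynomial (Fin d) K) =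
        if n = e.degree then monomial e c else 0 :=
      homogeneousComponent_of_mem (isHomogeneous_monomial c rfl)
    rw [presentation_monomial hpos]
    by_cases hn : n = e.degree
    · subst hn
      rw [component_form_self]
      congr 3
      rw [hc, if_pos rfl]
    · rw [component_form_of_ne _ _ hn, eq_comm, cls_eq_zero_iff, hc, if_neg hn, map_zero, map_zero]
      exact zero_mem _
  | add p q hp hq =>
    rw [map_add, map_add, hp (hmem p), hq (hmem q)]
    change cls _ _ _ (add_mem (hmem p) (hmem q)) = _
    congr 1
    simp only [map_add]

/-- A polynomial lies in the defining ideal if and only if for each element `s` of the Apéry set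
the coefficients of the maximal representations of `s` add up to zero. -/
theorem mem_definingIdeal_iff (hpos : ∀ i, 0 < g i) (f : MvPolynomial (Fin d) K) :
    f ∈ definingIdeal K g ↔
      ∀ s ∈ apery g, ∑ e ∈ f.support with e.degree = ord g s ∧ value g e = s, f.coeff e = 0 := by
  have hmem : ∀ n, toReduced K g (evalGen K g (homogeneousComponent n f)) ∈
      maxIdeal K g ^ n := fun n => evalGen_mem_pow hpos fun e he => by
    rw [support_homogeneousComponent, Finset.mem_filter] at he
    exact he.2
  have hco : ∀ n s, (evalGen K g (homogeneousComponent n f) : Polynomial K).coeff s =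
      ∑ e ∈ f.support with e.degree = n ∧ value g e = s, f.coeff e := fun n s => by
    rw [coeff_evalGen, support_homogeneousComponent, Finset.filter_filter]
    refine Finset.sum_congr rfl fun e he => ?_
    rw [coeff_homogeneousComponent, if_pos (Finset.mem_filter.1 he).2.1]
  -- The degree n component of the image vanishes iff the evaluated homogeneous part falls into the
  -- next power of the maximal ideal.
  have h0 : f ∈ definingIdeal K g ↔
      ∀ n, evalGen K g (homogeneousComponent n f) ∈ orderIdeal K hpos (n + 1) := by
    rw [definingIdeal, RingHom.mem_ker, eq_zero_iff_component]
    refine forall_congr' fun n => ?_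
    rw [component_presentation hpos f n (hmem n), ← toReduced_mem_pow_iff hpos]
    exact cls_eq_zero_iff _
  rw [h0]
  constructor
  · intro h s hs
    by_contra hne
    rw [← hco] at hne
    have := h (ord g s) s hs hne
    omega
  · intro h n s hs hne
    rw [hco] at hne
    obtain ⟨e, he, _⟩ := Finset.exists_ne_zero_of_sum_ne_zero hne
    obtain ⟨_, he1, he2⟩ := Finset.mem_filter.1 he
    have hle := degree_le_ord hpos e
    -- Terms with n < ord(s) satisfy the bound automatically; only n = ord(s) carries a condition.
    rw [he1, he2] at hle
    rcases hle.lt_or_eq with hlt | rfl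
    · exact hlt
    · exact absurd (h s hs) hne

end DefiningIdeal


open MvPolynomial

/-! ### Monomials and binomials in the defining ideal -/

section Membership

variable {K : Type*} [Field K] {d : ℕ} {g : Fin (d + 1) → ℕ}

theorem monomial_mem_definingIdeal_iff (hpos : ∀ i, 0 < g i) (e : Fin d →₀ ℕ) :
    (monomial e 1 : MvPolynomial (Fin d) K) ∈ definingIdeal K g ↔ ¬ IsStandard g e := by
  classical
  rw [mem_definingIdeal_iff hpos, support_monomial, if_neg one_ne_zero]
  simp only [Finset.filter_singleton]
  constructor
  · intro h hs
    have := h _ hs.1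
    simp [hs.2] at this
  · intro h s hs
    rw [if_neg, Finset.sum_empty]
    rintro ⟨h1, rfl⟩
    exact h ⟨hs, h1.symm⟩

theorem monomial_sub_mem_definingIdeal (hpos : ∀ i, 0 < g i) {e f : Fin d →₀ ℕ}
    (hd : e.degree = f.degree) (hv : value g e = value g f) :
    (monomial e 1 - monomial f 1 : MvPolynomial (Fin d) K) ∈ definingIdeal K g := by
  rw [definingIdeal, RingHom.mem_ker, map_sub, sub_eq_zero, presentation_monomial hpos,
    presentation_monomial hpos]
  refine AssocGraded.form_congr _ _ _ hd (congrArg _ (Subtype.ext ?_))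
  rw [coe_evalGen_monomial, coe_evalGen_monomial, hv]

/-- The sum over maximal representations collapses to one coefficient. It serves both isolated pure
powers and polynomials supported in the box. -/
theorem coeff_eq_zero_of_mem_definingIdeal (hpos : ∀ i, 0 < g i) {f : MvPolynomial (Fin d) K}
    (hf : f ∈ definingIdeal K g) {e : Fin d →₀ ℕ} (he : IsStandard g e)
    (h : ∀ e' ∈ f.support, IsStandard g e' → value g e' = value g e → e' = e) :
    f.coeff e = 0 := by
  have h1 := (mem_definingIdeal_iff hpos f).1 hf _ he.1
  rw [Finset.sum_eq_single e] at h1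
  · exact h1
  · intro e' he' hne
    obtain ⟨h2, h3, h4⟩ := Finset.mem_filter.1 he'
    exact absurd (h e' h2 ⟨h4 ▸ he.1, by rw [h4, h3]⟩ h4) hne
  · intro hne
    by_contra h0
    exact hne (Finset.mem_filter.2 ⟨mem_support_iff.2 h0, he.2.symm, rfl⟩)

end Membership

/-! ### The relations attached to the variables -/

section Relations

variable {d : ℕ} (g : Fin (d + 1) → ℕ)

/-- The pure power of the `i`-th variable just beyond the bound `γ i`. -/
noncomputable def corner (i : Fin d) : Fin d →₀ ℕ := Finsupp.single i (gamma g i + 1)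

open Classical in
/-- A standard exponent for which the corner of `i` can be exchanged, if the corner is
standard. -/
noncomputable def exchange (i : Fin d) : Option (Fin d →₀ ℕ) :=
  if h : ∃ e, IsStandard g e ∧ value g e = value g (corner g i) ∧ e ≠ corner g i ∧
      IsStandard g (corner g i) then some h.choose else none

/-- The monomial of an exponent, or zero. -/
noncomputable def optMonomial (K : Type*) [Field K] (o : Option (Fin d →₀ ℕ)) :
    MvPolynomial (Fin d) K :=
  o.elim 0 fun e => monomial e 1

/-- The relation that rewrites the corner of `i`. -/
noncomputable def relation (K : Type*) [Field K] (i : Fin d) : MvPolynomial (Fin d) K :=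
  monomial (corner g i) 1 - optMonomial K (exchange g i)

/-- The ideal generated by the relations of the variables. -/
noncomputable def relationIdeal (K : Type*) [Field K] : Ideal (MvPolynomial (Fin d) K) :=
  Ideal.span (Set.range (relation g K))

/-- One rewriting step modulo the relations of the variables. -/
def Step (a b : Option (Fin d →₀ ℕ)) : Prop :=
  ∃ i u, a = some (corner g i + u) ∧ b = (exchange g i).map (· + u)

/-- All entries of the exponent are at most the bounds `γ i`. -/
def InBox (e : Fin d →₀ ℕ) : Prop := ∀ i, e i ≤ gamma g i

variable {g}

theorem exchange_eq_some {i : Fin d} {e : Fin d →₀ ℕ} (h : exchange g i = some e) :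
    IsStandard g e ∧ value g e = value g (corner g i) ∧ e ≠ corner g i ∧
      IsStandard g (corner g i) := by
  unfold exchange at h
  split_ifs at h with h'
  exact Option.some.inj h ▸ h'.choose_spec

theorem exchange_eq_none (hpos : ∀ i, 0 < g i) {i : Fin d} (h : exchange g i = none) :
    ¬ IsStandard g (corner g i) := by
  intro hs
  unfold exchange at h
  split_ifs at h with h'
  obtain ⟨e, h1, h2, h3⟩ := exists_exchange hpos hs
  exact h' ⟨e, h1, h2, h3, hs⟩

theorem degree_exchange {i : Fin d} {e : Fin d →₀ ℕ} (h : exchange g i = some e) :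
    e.degree = (corner g i).degree :=
  have h' := exchange_eq_some h
  h'.1.degree_eq h'.2.2.2 h'.2.1

theorem corner_le_iff {i : Fin d} {e : Fin d →₀ ℕ} : corner g i ≤ e ↔ gamma g i < e i :=
  Finsupp.single_le_iff

variable {K : Type*} [Field K]

theorem relation_mem_definingIdeal (hpos : ∀ i, 0 < g i) (i : Fin d) :
    relation g K i ∈ definingIdeal K g := by
  unfold relation
  rcases h : exchange g i with _ | e
  · simpa [optMonomial] using
      (monomial_mem_definingIdeal_iff hpos _).2 (exchange_eq_none hpos h)
  · exact monomial_sub_mem_definingIdeal hpos (degree_exchange h).symm (exchange_eq_some h).2.1.symm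

theorem relationIdeal_le (hpos : ∀ i, 0 < g i) : relationIdeal g K ≤ definingIdeal K g := by
  refine Ideal.span_le.2 ?_
  rintro _ ⟨i, rfl⟩
  exact relation_mem_definingIdeal hpos i

theorem monomial_mul_relation (i : Fin d) (u : Fin d →₀ ℕ) :
    monomial u 1 * relation g K i =
      monomial (corner g i + u) 1 - optMonomial K ((exchange g i).map (· + u)) := by
  unfold relation
  rw [mul_sub, monomial_mul, mul_one, add_comm u]
  rcases exchange g i with _ | e
  · simp [optMonomial]
  · simp [optMonomial, monomial_mul, add_comm u]

theorem monomial_sub_mem_relationIdeal (i : Fin d) (u : Fin d →₀ ℕ) :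
    monomial (corner g i + u) 1 - optMonomial K ((exchange g i).map (· + u)) ∈
      relationIdeal g K := by
  rw [← monomial_mul_relation]
  exact Ideal.mul_mem_left _ _ (Ideal.subset_span ⟨i, rfl⟩)

/-- Modulo the relations of the variables, each monomial is zero or equal to a monomial in the
box. -/
theorem exists_normalForm (hinj : Function.Injective g)
    (e : Fin d →₀ ℕ) :
    ∃ o, monomial e 1 - optMonomial K o ∈ relationIdeal g K ∧ ∀ f ∈ o, InBox g f ∧
      f.degree = e.degree ∧ value g f = value g e ∧ (f = e ∨ weight g e < weight g f) := by
  -- Rewriting fixes the degree, hence the upper bound on the weight, and raises the weight; the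
  -- remaining gap decreases.
  induction hm : e.degree * (∑ i : Fin d, g i.succ ^ 2) - weight g e
    using Nat.strong_induction_on generalizing e with
  | _ m ih =>
    by_cases hbox : InBox g e
    · refine ⟨some e, by simp [optMonomial], ?_⟩
      rintro f ⟨⟩
      exact ⟨hbox, rfl, rfl, Or.inl rfl⟩
    unfold InBox at hbox
    push Not at hbox
    obtain ⟨i, hi⟩ := hbox
    obtain ⟨u, rfl⟩ := exists_add_of_le (corner_le_iff.2 hi)
    have hJ := monomial_sub_mem_relationIdeal (K := K) (g := g) i u
    rcases hx : exchange g i with _ | c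
    · refine ⟨none, by simpa [hx] using hJ, ?_⟩
      rintro f ⟨⟩
    · rw [hx] at hJ
      obtain ⟨_, h2, h3, _⟩ := exchange_eq_some hx
      have h4 : c.degree = (corner g i).degree := degree_exchange hx
      have hw : weight g (corner g i + u) < weight g (c + u) := by
        rw [weight_add, weight_add]
        have := weight_single_lt hinj (by rw [h4, corner, Finsupp.degree_single]) h2 h3
        exact Nat.add_lt_add_right this _
      have hdeg : (c + u).degree = (corner g i + u).degree := by
        rw [map_add, map_add, h4]
      have hval : value g (c + u) = value g (corner g i + u) := by
        rw [value_add, value_add, h2]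
      have hle := weight_le (g := g) (c + u)
      rw [hdeg] at hle
      obtain ⟨o, ho, ho'⟩ := ih _ (by rw [hdeg]; omega) (c + u) rfl
      refine ⟨o, ?_, fun f hf => ?_⟩
      · have := add_mem hJ ho
        simpa [optMonomial] using this
      · obtain ⟨k1, k2, k3, k4⟩ := ho' f hf
        refine ⟨k1, k2.trans hdeg, k3.trans hval, Or.inr ?_⟩
        rcases k4 with rfl | k4
        · exact hw
        · exact hw.trans k4

theorem exists_normalForm_polynomial (hinj : Function.Injective g)
    (p : MvPolynomial (Fin d) K) :
    ∃ q, (∀ e ∈ q.support, InBox g e) ∧ p - q ∈ relationIdeal g K := by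
  classical
  induction p using MvPolynomial.induction_on' with
  | monomial e c =>
    obtain ⟨o, ho, ho'⟩ := exists_normalForm (K := K) hinj e
    refine ⟨C c * optMonomial K o, fun f hf => ?_, ?_⟩
    · rcases o with _ | k
      · simp [optMonomial] at hf
      · simp only [optMonomial, Option.elim_some, C_mul_monomial] at hf
        rw [Finset.mem_singleton.1 (support_monomial_subset hf)]
        exact (ho' k rfl).1
    · have := Ideal.mul_mem_left _ (C c) ho
      rwa [mul_sub, C_mul_monomial, mul_one] at this
  | add p q hp hq =>
    obtain ⟨p', h1, h2⟩ := hp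
    obtain ⟨q', h3, h4⟩ := hq
    refine ⟨p' + q', fun e he => ?_, ?_⟩
    · exact (Finset.mem_union.1 (support_add he)).elim (h1 e) (h3 e)
    · rw [add_sub_add_comm]
      exact add_mem h2 h4

/-- Rewriting a standard monomial cannot end in zero, as J ⊆ I, and the preserved degree and value
keep the result standard. -/
theorem exists_isStandard_inBox (hpos : ∀ i, 0 < g i) (hinj : Function.Injective g)
    {e : Fin d →₀ ℕ} (he : IsStandard g e) :
    ∃ f, IsStandard g f ∧ InBox g f ∧ value g f = value g e ∧
      (f = e ∨ weight g e < weight g f) := by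
  -- The claim is purely combinatorial, so any coefficient field serves.
  obtain ⟨o, ho, ho'⟩ := exists_normalForm (K := ℚ) hinj e
  rcases o with _ | f
  · refine absurd he ((monomial_mem_definingIdeal_iff (K := ℚ) hpos e).1 ?_)
    simpa [optMonomial] using relationIdeal_le hpos ho
  · obtain ⟨h1, h2, h3, h4⟩ := ho' f rfl
    exact ⟨f, ⟨h3 ▸ he.1, by rw [h3, he.2, h2]⟩, h1, h3, h4⟩

theorem value_mem_hyperRectangle {b : Fin d → ℕ} {e : Fin d →₀ ℕ} (he : ∀ i, e i ≤ b i) :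
    value g e ∈ hyperRectangle g b :=
  ⟨e, he, rfl⟩

theorem apery_subset_hyperRectangle_gamma (hpos : ∀ i, 0 < g i)
    (hinj : Function.Injective g) : apery g ⊆ hyperRectangle g (gamma g) := by
  intro s hs
  obtain ⟨e, he, rfl⟩ := exists_isStandard hpos hs
  obtain ⟨f, _, h1, h2, _⟩ := exists_isStandard_inBox hpos hinj he
  rw [← h2]
  exact value_mem_hyperRectangle h1

theorem eq_of_le_of_value_eq (hpos : ∀ i, 0 < g i) {e f : Fin d →₀ ℕ} (hle : e ≤ f)
    (hv : value g e = value g f) : e = f := by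
  obtain ⟨u, rfl⟩ := exists_add_of_le hle
  rw [value_add, left_eq_add, value, Finset.sum_eq_zero_iff] at hv
  have : u = 0 := by
    ext i
    have := hv i (Finset.mem_univ i)
    exact (Nat.mul_eq_zero.1 this).resolve_right (hpos i.succ).ne'
  rw [this, add_zero]

/-! ### From the Apéry set to complete intersections -/

/-- The exponent with entries `γ i`. -/
noncomputable def top (g : Fin (d + 1) → ℕ) : Fin d →₀ ℕ :=
  Finsupp.equivFunOnFinite.symm (gamma g)

theorem inBox_iff_le_top {e : Fin d →₀ ℕ} : InBox g e ↔ e ≤ top g := Iff.rfl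

/-- Every box exponent lies below `top g`, so positivity of the generators makes `top g` the only
box exponent of its value; rewriting e must end there. -/
theorem eq_top_of_isStandard (hpos : ∀ i, 0 < g i) (hinj : Function.Injective g)
    {e : Fin d →₀ ℕ} (he : IsStandard g e) (hv : value g e = value g (top g)) :
    IsStandard g (top g) ∧ (top g = e ∨ weight g e < weight g (top g)) := by
  obtain ⟨f, h1, h2, h3, h4⟩ := exists_isStandard_inBox hpos hinj he
  obtain rfl : f = top g := eq_of_le_of_value_eq hpos (inBox_iff_le_top.1 h2) (h3.trans hv)
  exact ⟨h1, h4⟩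

theorem isStandard_of_inBox (hpos : ∀ i, 0 < g i) (hinj : Function.Injective g)
    (h : apery g = hyperRectangle g (gamma g)) {e : Fin d →₀ ℕ} (he : InBox g e) :
    IsStandard g e := by
  have h1 : value g (top g) ∈ apery g := by
    rw [h]
    exact value_mem_hyperRectangle fun _ => le_rfl
  obtain ⟨f, h2, h3⟩ := exists_isStandard hpos h1
  exact (eq_top_of_isStandard hpos hinj h2 h3).1.of_le hpos (inBox_iff_le_top.1 he)

theorem eq_or_weight_lt_of_inBox (hpos : ∀ i, 0 < g i) (hinj : Function.Injective g)
    (h : apery g = hyperRectangle g (gamma g)) {e f : Fin d →₀ ℕ} (he : InBox g e)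
    (hf : InBox g f) (hv : value g f = value g e) : e = f ∨ weight g f < weight g e := by
  obtain ⟨u, hu⟩ := exists_add_of_le (inBox_iff_le_top.1 he)
  have hse := isStandard_of_inBox hpos hinj h he
  have hsf := isStandard_of_inBox hpos hinj h hf
  -- With u the complement of e in the box, f + u is standard and has the value of `top g`, so it
  -- rewrites to `top g` = e + u. Cancelling u compares the weights of e and f.
  have htop : IsStandard g (e + u) := hu ▸ isStandard_of_inBox hpos hinj h (fun _ => le_rfl)
  have h1 := (eq_top_of_isStandard hpos hinj
    (htop.add_of_value_eq hv (hsf.degree_eq hse hv)) (by rw [hu, value_add, value_add, hv])).2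
  rw [hu, add_left_inj, weight_add, weight_add, add_lt_add_iff_right] at h1
  exact h1

theorem value_injOn_inBox (hpos : ∀ i, 0 < g i) (hinj : Function.Injective g)
    (h : apery g = hyperRectangle g (gamma g)) {e f : Fin d →₀ ℕ} (he : InBox g e)
    (hf : InBox g f) (hv : value g f = value g e) : f = e := by
  rcases eq_or_weight_lt_of_inBox hpos hinj h he hf hv with h1 | h1
  · exact h1.symm
  · rcases eq_or_weight_lt_of_inBox hpos hinj h hf he hv.symm with h2 | h2
    · exact h2
    · exact absurd h1 h2.asymm

/-- Box monomials are standard with distinct values, so each coefficient of a box-supported element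
of I vanishes. Hence every element of I has normal form zero modulo J. -/
theorem definingIdeal_eq_relationIdeal (hpos : ∀ i, 0 < g i) (hinj : Function.Injective g)
    (h : apery g = hyperRectangle g (gamma g)) : definingIdeal K g = relationIdeal g K := by
  refine le_antisymm (fun p hp => ?_) (relationIdeal_le hpos)
  obtain ⟨q, h1, h2⟩ := exists_normalForm_polynomial hinj p
  have hq : q ∈ definingIdeal K g := by
    have := sub_mem hp (relationIdeal_le hpos h2)
    rwa [sub_sub_cancel] at this
  have h0 : q = 0 := by
    ext e
    by_cases he : e ∈ q.support
    · exact coeff_eq_zero_of_mem_definingIdeal hpos hq (isStandard_of_inBox hpos hinj h (h1 e he))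
        fun e' he' _ hv => value_injOn_inBox hpos hinj h (h1 e he) (h1 e' he') hv
    · exact notMem_support_iff.1 he
  rwa [h0, sub_zero] at h2

/-! ### Minimal generators -/

/-- The coefficients of a polynomial at the corners. -/
noncomputable def cornerCoeff (K : Type*) [Field K] (g : Fin (d + 1) → ℕ) :
    MvPolynomial (Fin d) K →ₗ[K] (Fin d → K) :=
  LinearMap.pi fun i => lcoeff K (corner g i)

theorem cornerCoeff_apply (p : MvPolynomial (Fin d) K) (i : Fin d) :
    cornerCoeff K g p i = p.coeff (corner g i) := rfl

theorem corner_injective : Function.Injective (corner g) := fun i j h => by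
  have := (Finsupp.single_eq_single_iff _ _ _ _).1 h
  omega

theorem exchange_ne_corner (hinj : Function.Injective g) (i j : Fin d) :
    exchange g i ≠ some (corner g j) := by
  intro h
  obtain ⟨_, h2, h3, _⟩ := exchange_eq_some h
  have h4 := degree_exchange h
  simp only [corner, value_single, Finsupp.degree_single] at h2 h4
  rw [h4] at h2
  have h5 := hinj (Nat.eq_of_mul_eq_mul_left (Nat.succ_pos _) h2)
  exact h3 (by rw [Fin.succ_injective d h5])

theorem cornerCoeff_relation (hinj : Function.Injective g) (i : Fin d) :
    cornerCoeff K g (relation g K i) = Pi.single i 1 := by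
  classical
  ext j
  have h0 : (optMonomial K (exchange g i)).coeff (corner g j) = 0 := by
    rcases h : exchange g i with _ | e
    · simp [optMonomial]
    · simp only [optMonomial, Option.elim_some, coeff_monomial]
      refine if_neg ?_
      rintro rfl
      exact exchange_ne_corner hinj i j h
  rw [cornerCoeff_apply, relation, coeff_sub, h0, sub_zero, coeff_monomial, Pi.single_apply]
  simp only [corner_injective.eq_iff, eq_comm]

/-- The corner coefficient of x_j p at i is zero unless j = i, when it is the coefficient of p at
x_i^γ_i. That power is isolated, so the coefficient vanishes for p in I. Thus `cornerCoeff` factors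
through I/𝔪I. -/
theorem cornerCoeff_mul_of_mem (hpos : ∀ i, 0 < g i) {a : MvPolynomial (Fin d) K}
    (ha : a ∈ idealOfVars (Fin d) K) {p : MvPolynomial (Fin d) K}
    (hp : p ∈ definingIdeal K g) : cornerCoeff K g (a * p) = 0 := by
  classical
  induction ha using Submodule.span_induction generalizing p with
  | mem x hx =>
    obtain ⟨j, rfl⟩ := hx
    ext i
    rw [cornerCoeff_apply, coeff_X_mul']
    split_ifs with h
    · obtain rfl : j = i := by
        by_contra hne
        simp [corner, Ne.symm hne] at h
      have : corner g j - Finsupp.single j 1 = Finsupp.single j (gamma g j) := by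
        rw [corner, ← Finsupp.single_tsub, Nat.add_sub_cancel]
      rw [this]
      have h1 := isIsolated_gamma hpos j
      exact coeff_eq_zero_of_mem_definingIdeal hpos hp h1.1 fun e' _ => h1.2 e'
    · rfl
  | zero => rw [zero_mul, map_zero]
  | add x y _ _ hx hy => rw [add_mul, map_add, hx hp, hy hp, add_zero]
  | smul c x _ hx =>
    rw [smul_eq_mul, mul_comm c, mul_assoc]
    exact hx (Ideal.mul_mem_left _ c hp)

theorem sub_C_mem_idealOfVars (a : MvPolynomial (Fin d) K) :
    a - C (constantCoeff a) ∈ idealOfVars (Fin d) K := by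
  rw [← pow_one (idealOfVars (Fin d) K), mem_pow_idealOfVars_iff']
  intro e he
  have : e = 0 := by rwa [Nat.lt_one_iff, Finsupp.degree_eq_zero_iff] at he
  subst this
  simp [constantCoeff_eq]

theorem cornerCoeff_mul (hpos : ∀ i, 0 < g i) (a : MvPolynomial (Fin d) K)
    {p : MvPolynomial (Fin d) K} (hp : p ∈ definingIdeal K g) :
    cornerCoeff K g (a * p) = constantCoeff a • cornerCoeff K g p := by
  have h := cornerCoeff_mul_of_mem hpos (sub_C_mem_idealOfVars a) hp
  rw [sub_mul, map_sub, sub_eq_zero, ← smul_eq_C_mul, map_smul] at h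
  exact h

section Generators

variable {ι : Type*} [Fintype ι] {v : ι → MvPolynomial (Fin d) K}

/-- The relations map to the unit vectors, and each is a combination of the v k in which only
constant terms of the coefficients matter. -/
theorem top_le_span_cornerCoeff (hpos : ∀ i, 0 < g i) (hinj : Function.Injective g)
    (hv : Ideal.span (Set.range v) = definingIdeal K g) :
    ⊤ ≤ Submodule.span K (Set.range fun k => cornerCoeff K g (v k)) := by
  have hmem : ∀ k, v k ∈ definingIdeal K g := fun k => hv ▸ Ideal.subset_span ⟨k, rfl⟩
  rw [← (Pi.basisFun K (Fin d)).span_eq, Submodule.span_le]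
  rintro _ ⟨i, rfl⟩
  have h1 : relation g K i ∈ Ideal.span (Set.range v) := hv ▸ relation_mem_definingIdeal hpos i
  obtain ⟨c, hc⟩ := (Submodule.mem_span_range_iff_exists_fun _).1 h1
  rw [Pi.basisFun_apply, ← cornerCoeff_relation hinj, ← hc, map_sum]
  refine Submodule.sum_mem _ fun k _ => ?_
  rw [smul_eq_mul, cornerCoeff_mul hpos _ (hmem k)]
  exact Submodule.smul_mem _ _ (Submodule.subset_span ⟨k, rfl⟩)

theorem le_card_of_span_eq (hpos : ∀ i, 0 < g i) (hinj : Function.Injective g)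
    (hv : Ideal.span (Set.range v) = definingIdeal K g) : d ≤ Fintype.card ι := by
  have h := finrank_range_le_card (R := K) fun k => cornerCoeff K g (v k)
  rwa [Set.finrank, top_le_iff.1 (top_le_span_cornerCoeff hpos hinj hv), finrank_top,
    Module.finrank_fin_fun] at h

/-- With exactly d generators their corner vectors are independent. Subtracting relations kills the
corner coefficients of p, so the remainder's coefficients on the generators have no constant term.
-/
theorem definingIdeal_le_sup (hpos : ∀ i, 0 < g i) (hinj : Function.Injective g)
    (hv : Ideal.span (Set.range v) = definingIdeal K g) (hcard : Fintype.card ι = d) :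
    definingIdeal K g ≤ relationIdeal g K ⊔ idealOfVars (Fin d) K * definingIdeal K g := by
  classical
  have hmem : ∀ k, v k ∈ definingIdeal K g := fun k => hv ▸ Ideal.subset_span ⟨k, rfl⟩
  have hind : LinearIndependent K fun k => cornerCoeff K g (v k) :=
    linearIndependent_of_top_le_span_of_card_eq_finrank
      (top_le_span_cornerCoeff hpos hinj hv) (by rw [hcard, Module.finrank_fin_fun])
  intro p hp
  have hq : ∑ i, cornerCoeff K g p i • relation g K i ∈ relationIdeal g K :=
    Submodule.sum_mem _ fun i _ => Submodule.smul_of_tower_mem _ _ (Ideal.subset_span ⟨i, rfl⟩)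
  set q := ∑ i, cornerCoeff K g p i • relation g K i with hqdef
  have h0 : cornerCoeff K g (p - q) = 0 := by
    rw [map_sub, sub_eq_zero, hqdef, map_sum]
    simp only [map_smul, cornerCoeff_relation hinj]
    exact pi_eq_sum_univ' _
  have h1 : p - q ∈ Ideal.span (Set.range v) := hv ▸ sub_mem hp (relationIdeal_le hpos hq)
  obtain ⟨c, hc⟩ := (Submodule.mem_span_range_iff_exists_fun _).1 h1
  rw [← hc, map_sum] at h0
  simp only [smul_eq_mul, cornerCoeff_mul hpos _ (hmem _)] at h0
  have h2 := Fintype.linearIndependent_iff.1 hind _ h0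
  rw [← add_sub_cancel q p]
  refine Submodule.add_mem_sup hq ?_
  rw [← hc]
  refine Submodule.sum_mem _ fun k _ => Ideal.mul_mem_mul ?_ (hmem k)
  have := sub_C_mem_idealOfVars (c k)
  rwa [h2 k, C_0, sub_zero] at this

end Generators

/-! ### Nakayama's argument for the relation ideal -/

/-- Rewriting preserves degree, and no box exponent has degree above that of `top g`, so such
monomials reduce to zero. This ends the Nakayama iteration without passing to a local ring. -/
theorem idealOfVars_pow_le (hinj : Function.Injective g) :
    idealOfVars (Fin d) K ^ ((top g).degree + 1) ≤ relationIdeal g K := by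
  rw [pow_idealOfVars_eq_span, Ideal.span_le]
  rintro _ ⟨e, he, rfl⟩
  obtain ⟨o, ho, ho'⟩ := exists_normalForm (K := K) hinj e
  rcases o with _ | f
  · simpa [optMonomial] using ho
  · obtain ⟨h1, h2, _⟩ := ho' f rfl
    have h3 := Finsupp.degree_mono (inBox_iff_le_top.1 h1)
    rw [Set.mem_preimage, Set.mem_singleton_iff] at he
    omega

theorem definingIdeal_eq_relationIdeal_of_card (hpos : ∀ i, 0 < g i)
    (hinj : Function.Injective g) {ι : Type*} [Fintype ι] {v : ι → MvPolynomial (Fin d) K}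
    (hv : Ideal.span (Set.range v) = definingIdeal K g) (hcard : Fintype.card ι = d) :
    definingIdeal K g = relationIdeal g K := by
  refine le_antisymm ?_ (relationIdeal_le hpos)
  have key := definingIdeal_le_sup hpos hinj hv hcard
  have hn : ∀ n, definingIdeal K g ≤
      relationIdeal g K ⊔ idealOfVars (Fin d) K ^ n * definingIdeal K g := by
    intro n
    induction n with
    | zero => simp
    | succ n ih =>
      refine ih.trans (sup_le le_sup_left ?_)
      refine (Ideal.mul_mono_right key).trans ?_
      rw [Ideal.mul_sup, ← mul_assoc, ← pow_succ]
      exact sup_le_sup_right Ideal.mul_le_right _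
  exact (hn _).trans (sup_le le_rfl (Ideal.mul_le_left.trans (idealOfVars_pow_le hinj)))

theorem isCompleteIntersection_iff (hpos : ∀ i, 0 < g i) (hinj : Function.Injective g) :
    IsCompleteIntersection K g ↔ definingIdeal K g = relationIdeal g K := by
  obtain ⟨t, ht, hspan⟩ := Submodule.FG.exists_span_finset_card_eq_spanFinrank
    (IsNoetherian.noetherian (definingIdeal K g))
  have hv : Ideal.span (Set.range (Subtype.val : t → MvPolynomial (Fin d) K)) =
      definingIdeal K g := by
    rw [Subtype.range_coe]
    exact hspan
  unfold IsCompleteIntersection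
  constructor
  · intro h
    exact definingIdeal_eq_relationIdeal_of_card hpos hinj hv
      (by rw [Fintype.card_coe, ht, h])
  · intro h
    refine le_antisymm ?_ ?_
    · rw [h]
      refine (Submodule.spanFinrank_span_le_ncard_of_finite (Set.finite_range _)).trans ?_
      rw [← Set.image_univ]
      refine (Set.ncard_image_le Set.finite_univ).trans ?_
      simp
    · rw [← ht, ← Fintype.card_coe]
      exact le_card_of_span_eq hpos hinj hv

/-! ### Confluence -/

/-- Distinct corners involve different variables, so two overlapping rewrites act on disjoint
factors and commute; if either gives zero, both branches reach zero. -/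
theorem Step.diamond {a b c : Option (Fin d →₀ ℕ)} (hb : Step g a b) (hc : Step g a c) :
    ∃ x, Relation.ReflGen (Step g) b x ∧ Relation.ReflTransGen (Step g) c x := by
  obtain ⟨i, u, rfl, rfl⟩ := hb
  obtain ⟨j, v, h, rfl⟩ := hc
  rw [Option.some.injEq] at h
  rcases eq_or_ne i j with rfl | hij
  · rw [add_left_cancel h]
    exact ⟨_, .refl, .refl⟩
  have hle : corner g j ≤ u := by
    rw [corner_le_iff]
    have := DFunLike.congr_fun h j
    simp only [Finsupp.add_apply, corner, Finsupp.single_eq_same,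
      Finsupp.single_eq_of_ne hij.symm] at this
    omega
  obtain ⟨w, rfl⟩ := exists_add_of_le hle
  obtain rfl : v = corner g i + w := by
    rw [add_left_comm] at h
    exact (add_left_cancel h).symm
  rcases hi : exchange g i with _ | x <;> rcases hj : exchange g j with _ | y
  · exact ⟨none, .refl, .refl⟩
  · exact ⟨none, .refl, .single ⟨i, y + w, by simp [add_left_comm], by simp [hi]⟩⟩
  · exact ⟨none, .single ⟨j, x + w, by simp [add_left_comm], by simp [hj]⟩, .refl⟩
  · exact ⟨some (x + (y + w)),
      .single ⟨j, x + w, by simp [add_left_comm], by simp [hj, add_left_comm]⟩,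
      .single ⟨i, y + w, by simp [add_left_comm], by simp [hi]⟩⟩

theorem InBox.not_step {e : Fin d →₀ ℕ} (he : InBox g e) (b : Option (Fin d →₀ ℕ)) :
    ¬ Step g (some e) b := by
  rintro ⟨i, u, h, -⟩
  rw [Option.some.injEq] at h
  have h1 : corner g i ≤ e := h ▸ le_self_add
  exact absurd (corner_le_iff.1 h1) (he i).not_gt

theorem InBox.eq_of_reflTransGen {e : Fin d →₀ ℕ} (he : InBox g e)
    {b : Option (Fin d →₀ ℕ)} (h : Relation.ReflTransGen (Step g) (some e) b) : b = some e := by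
  rcases h.cases_head with h | ⟨c, hc, _⟩
  · exact h.symm
  · exact absurd hc (he.not_step c)

/-- By confluence a and b keep a common descendant with e, and box exponents are irreducible, so
that descendant is e itself. -/
theorem InBox.reflTransGen_iff {e : Fin d →₀ ℕ} (he : InBox g e)
    {a b : Option (Fin d →₀ ℕ)} (h : Step g a b) :
    Relation.ReflTransGen (Step g) a (some e) ↔ Relation.ReflTransGen (Step g) b (some e) := by
  refine ⟨fun ha => ?_, fun hb => .head h hb⟩
  obtain ⟨x, hx, hx'⟩ := Relation.church_rosser (fun _ _ _ => Step.diamond) ha (.single h)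
  rwa [he.eq_of_reflTransGen hx] at hx'

open Classical in
/-- The linear form taking the value one on the monomials that are rewritten to `e`, and the
value zero on all others. -/
noncomputable def rewriteForm (K : Type*) [Field K] (g : Fin (d + 1) → ℕ) (e : Fin d →₀ ℕ) :
    MvPolynomial (Fin d) K →ₗ[K] K :=
  (basisMonomials (Fin d) K).constr K fun u =>
    if Relation.ReflTransGen (Step g) (some u) (some e) then 1 else 0

open Classical in
theorem rewriteForm_optMonomial (e : Fin d →₀ ℕ) (o : Option (Fin d →₀ ℕ)) :
    rewriteForm K g e (optMonomial K o) =
      if Relation.ReflTransGen (Step g) o (some e) then 1 else 0 := by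
  rcases o with _ | u
  · rw [if_neg]
    · exact map_zero _
    · intro h
      rcases h.cases_head with h | ⟨c, ⟨i, u, h, _⟩, _⟩ <;> cases h
  · have := (basisMonomials (Fin d) K).constr_basis K
      (fun u => if Relation.ReflTransGen (Step g) (some u) (some e) then (1 : K) else 0) u
    rwa [coe_basisMonomials] at this

/-- A monomial multiple of a relation is the difference of the two ends of a `Step`, and these are
rewritten to e together or not at all. So the form vanishes on J but not on the box monomial e. -/
theorem rewriteForm_mul_relation {e : Fin d →₀ ℕ} (he : InBox g e)
    (a : MvPolynomial (Fin d) K) (i : Fin d) : rewriteForm K g e (a * relation g K i) = 0 := by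
  classical
  induction a using MvPolynomial.induction_on' with
  | monomial u c =>
    have h1 : (monomial u c : MvPolynomial (Fin d) K) = c • monomial u 1 := by
      rw [smul_monomial, smul_eq_mul, mul_one]
    rw [h1, smul_mul_assoc, map_smul, monomial_mul_relation, map_sub]
    have h2 : (monomial (corner g i + u) 1 : MvPolynomial (Fin d) K) =
        optMonomial K (some (corner g i + u)) := rfl
    rw [h2, rewriteForm_optMonomial, rewriteForm_optMonomial,
      if_congr (he.reflTransGen_iff ⟨i, u, rfl, rfl⟩) rfl rfl, sub_self, smul_zero]
  | add p q hp hq => rw [add_mul, map_add, hp, hq, add_zero]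

theorem InBox.monomial_notMem_relationIdeal {e : Fin d →₀ ℕ} (he : InBox g e) :
    (monomial e 1 : MvPolynomial (Fin d) K) ∉ relationIdeal g K := by
  classical
  intro h
  obtain ⟨c, hc⟩ := (Submodule.mem_span_range_iff_exists_fun _).1 h
  have h1 : rewriteForm K g e (optMonomial K (some e)) = 0 := by
    change rewriteForm K g e (monomial e 1) = 0
    rw [← hc, map_sum]
    exact Finset.sum_eq_zero fun i _ => rewriteForm_mul_relation he _ i
  rw [rewriteForm_optMonomial, if_pos .refl] at h1
  exact one_ne_zero h1

theorem isCompleteIntersection_iff_apery_eq (hpos : ∀ i, 0 < g i)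
    (hinj : Function.Injective g) :
    IsCompleteIntersection K g ↔ apery g = hyperRectangle g (gamma g) := by
  rw [isCompleteIntersection_iff hpos hinj]
  refine ⟨fun h => ?_, definingIdeal_eq_relationIdeal hpos hinj⟩
  refine (apery_subset_hyperRectangle_gamma hpos hinj).antisymm ?_
  rintro s ⟨l, hl, rfl⟩
  have hbox : InBox g (Finsupp.equivFunOnFinite.symm l) := hl
  have h1 := hbox.monomial_notMem_relationIdeal (K := K)
  rw [← h, monomial_mem_definingIdeal_iff hpos, not_not] at h1
  exact h1.1

/-! ### Monomial complete intersections -/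

theorem hyperRectangle_mono {b b' : Fin d → ℕ} (h : b ≤ b') :
    hyperRectangle g b ⊆ hyperRectangle g b' := by
  rintro s ⟨l, hl, rfl⟩
  exact ⟨l, fun i => (hl i).trans (h i), rfl⟩

/-- The largest element ∑ b'_i g_i of the bigger set would exceed everything in the smaller one if
some bound were strictly smaller. -/
theorem eq_of_hyperRectangle_eq (hpos : ∀ i, 0 < g i) {b b' : Fin d → ℕ} (h : b ≤ b')
    (heq : hyperRectangle g b = hyperRectangle g b') : b = b' := by
  have hmem : ∑ i, b' i * g i.succ ∈ hyperRectangle g b := by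
    rw [heq]
    exact ⟨b', fun _ => le_rfl, rfl⟩
  obtain ⟨l, hl, hs⟩ := hmem
  refine le_antisymm h ?_
  by_contra hlt
  obtain ⟨i, hi⟩ : ∃ i, ¬ b' i ≤ b i := by
    by_contra! H
    exact hlt H
  have : ∑ i, l i * g i.succ < ∑ i, b' i * g i.succ :=
    Finset.sum_lt_sum (fun j _ => Nat.mul_le_mul_right _ ((hl j).trans (h j)))
      ⟨i, Finset.mem_univ i, Nat.mul_lt_mul_of_pos_right
        ((hl i).trans_lt (not_le.1 hi)) (hpos i.succ)⟩
  omega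

/-- If γ_i < β_i, the corner is standard and its exchange gives a binomial in I; a monomial ideal
would contain the corner itself. -/
theorem gamma_eq_beta_of_isGeneratedByMonomials (hpos : ∀ i, 0 < g i)
    (h : IsGeneratedByMonomials (definingIdeal K g)) : gamma g = beta g := by
  classical
  funext i
  refine (gamma_le_beta hpos i).antisymm (not_lt.1 fun hlt => ?_)
  have hs : IsStandard g (corner g i) := (gamma_lt_beta_iff hpos i).1 hlt
  obtain ⟨e, he, hv, hne⟩ := exists_exchange hpos hs
  change e ≠ corner g i at hne
  obtain ⟨E, hE⟩ := h
  have hmem := monomial_sub_mem_definingIdeal (K := K) hpos (hs.degree_eq he hv.symm) hv.symm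
  refine (monomial_mem_definingIdeal_iff (K := K) hpos (corner g i)).1 ?_ hs
  rw [hE, mem_ideal_span_monomial_image] at hmem ⊢
  intro x hx
  obtain rfl := Finset.mem_singleton.1 (support_monomial_subset hx)
  refine hmem _ (mem_support_iff.2 ?_)
  rw [coeff_sub, coeff_monomial, coeff_monomial, if_pos rfl, if_neg hne, sub_zero]
  exact one_ne_zero

theorem isGeneratedByMonomials_relationIdeal (hpos : ∀ i, 0 < g i) (h : gamma g = beta g) :
    IsGeneratedByMonomials (relationIdeal g K) := by
  refine ⟨Set.range (corner g), ?_⟩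
  rw [relationIdeal, ← Set.range_comp]
  congr 2
  funext i
  have hx : exchange g i = none := by
    rcases hx : exchange g i with _ | e
    · rfl
    · have := (gamma_lt_beta_iff hpos i).2 (exchange_eq_some hx).2.2.2
      rw [h] at this
      exact absurd this (lt_irrefl _)
  simp [relation, hx, optMonomial]

theorem isCompleteIntersection_and_monomial_iff (hpos : ∀ i, 0 < g i)
    (hinj : Function.Injective g) :
    IsCompleteIntersection K g ∧ IsGeneratedByMonomials (definingIdeal K g) ↔
      apery g = hyperRectangle g (beta g) := by
  constructor
  · rintro ⟨h1, h2⟩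
    rw [← gamma_eq_beta_of_isGeneratedByMonomials hpos h2]
    exact (isCompleteIntersection_iff_apery_eq hpos hinj).1 h1
  · intro h
    -- Ap(S) ⊆ Γ ⊆ B always, so Ap(S) = B collapses the chain.
    have h1 : apery g = hyperRectangle g (gamma g) :=
      (apery_subset_hyperRectangle_gamma hpos hinj).antisymm
        (h ▸ hyperRectangle_mono fun i => gamma_le_beta hpos i)
    refine ⟨(isCompleteIntersection_iff_apery_eq hpos hinj).2 h1, ?_⟩
    rw [definingIdeal_eq_relationIdeal hpos hinj h1]
    exact isGeneratedByMonomials_relationIdeal hpos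
      (eq_of_hyperRectangle_eq hpos (fun i => gamma_le_beta hpos i) (h1.symm.trans h))

end Relations

end AperyAlgebra

theorem theorem4 (K : Type*) [Field K] [CharZero K] (d : ℕ) (g : Fin (d + 1) → ℕ)
    (hg : AperyAlgebra.IsMinimalSystem g) :
    (AperyAlgebra.IsCompleteIntersection K g ↔
      AperyAlgebra.apery g = AperyAlgebra.hyperRectangle g (AperyAlgebra.gamma g)) ∧
    ((AperyAlgebra.IsCompleteIntersection K g ∧
        AperyAlgebra.IsGeneratedByMonomials (AperyAlgebra.definingIdeal K g)) ↔
      AperyAlgebra.apery g = AperyAlgebra.hyperRectangle g (AperyAlgebra.beta g)) :=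
  ⟨AperyAlgebra.isCompleteIntersection_iff_apery_eq hg.pos hg.strictMono.injective,
    AperyAlgebra.isCompleteIntersection_and_monomial_iff hg.pos hg.strictMono.injective⟩
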